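/- **Theorem.** Let $\mu>0$. For $\Re p>0$ or $p=0$ let $$\zeta_p(\alpha)=\frac1{\Gamma(\alpha)}\int_0^\infty\frac{x^{\alpha-1}e^{-p/x}}{e^x-1}\,dx$$ (with $\Re\alpha>0$, and $\Re\alpha>1$ when $p=0$) be the $p$-extended Riemann zeta function, $\binom ab=\frac{\Gamma(a+1)}{\Gamma(b+1)\Gamma(a-b+1)}$ the generalized binomial coefficient, and let $S_{\mu,p}$ be the $p$-extended Mathieu series, defined for real $r$ with $|r|<1$ by $$S_{\mu,p}(r)=2\sum_{n\ge0}(-1)^n\binom{\mu+n}{n}\zeta_p(2\mu+2n+1)\,r^{2n},$$ and for $r\ge1$, where this series diverges, by its continuation $$S_{\mu,p}(r)=\frac{\sqrt\pi}{(2r)^{\mu-1/2}\,\Gamma(\mu+1)}\int_0^\infty\frac{x^{\mu+1/2}e^{-p/x}}{e^x-1}J_{\mu-1/2}(rx)\,dx,$$ where $J_\nu$ is the Bessel function of the first kind. (i) For every real $r$ with $|r|<1$ and every $s\in\mathbb C$ with $\Re s>0$, the Mellin transform in $p$ exists (as an absolutely convergent integral), the series below converges absolutely, and $$\int_0^\infty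 p^{s-1}S_{\mu,p}(r)\,dp=2s\,\Gamma(s)^2\sum_{n\ge0}(-r^2)^n\binom{\mu+n}{n}\binom{2\mu+2n+s}{2\mu+2n}\zeta(2\mu+2n+s+1),$$ where $\zeta$ is the Riemann zeta function. (ii) For all $p,s\in\mathbb C$ with $\Re p>0$ and $0<\Re s<\mu+1$, the Mellin transform in $r$ exists (as an absolutely convergent integral), and $$\int_0^\infty r^{s-1}S_{\mu,p}(r)\,dr=\mathrm B\!\left(\frac s2,\ \mu+1-\frac s2\right)\zeta_p(2\mu-s+1),$$ where $\mathrm B$ is the Euler Beta function. -/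

import Mathlib

open MeasureTheory Set

namespace ExtMathieu

/-- The `p`-extended Riemann zeta function
`ζ_p(α) = Γ(α)⁻¹ ∫₀^∞ x^(α-1) e^(-p/x) / (e^x - 1) dx`. -/
noncomputable def zetaExt (p α : ℂ) : ℂ :=
  1 / Complex.Gamma α *
    ∫ x in Ioi (0 : ℝ),
      (x : ℂ) ^ (α - 1) * Complex.exp (-p / (x : ℂ)) / (Complex.exp (x : ℂ) - 1)

/-- The generalized binomial coefficient `Γ(a+1) / (Γ(b+1) Γ(a-b+1))`. -/
noncomputable def binom (a b : ℂ) : ℂ :=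
  Complex.Gamma (a + 1) / (Complex.Gamma (b + 1) * Complex.Gamma (a - b + 1))

/-- The Bessel function of the first kind `J_ν(x)`, of real order `ν`, at `x > 0`. -/
noncomputable def besselJ (ν x : ℝ) : ℝ :=
  ∑' n : ℕ, (-1) ^ n / ((n.factorial : ℝ) * Real.Gamma (n + ν + 1)) *
    (x / 2) ^ (2 * (n : ℝ) + ν)

/-- The power series `2 ∑ (-1)^n C(μ+n, n) ζ_p(2μ+2n+1) r^(2n)`, which converges for `|r| < 1`. -/
noncomputable def mathieuPowerSeries (μ : ℝ) (p : ℂ) (r : ℝ) : ℂ :=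
  2 * ∑' n : ℕ, (r : ℂ) ^ (2 * n) * (-1) ^ n * binom (μ + n) n * zetaExt p (2 * μ + 2 * n + 1)

/-- The integral
`√π / ((2r)^(μ-1/2) Γ(μ+1)) ∫₀^∞ x^(μ+1/2) e^(-p/x) / (e^x - 1) J_(μ-1/2)(r x) dx` for `r > 0`. -/
noncomputable def mathieuIntegral (μ : ℝ) (p : ℂ) (r : ℝ) : ℂ :=
  ((√Real.pi / ((2 * r) ^ (μ - 1 / 2) * Real.Gamma (μ + 1)) : ℝ) : ℂ) *
    ∫ x in Ioi (0 : ℝ),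
      ((x ^ (μ + 1 / 2) : ℝ) : ℂ) * Complex.exp (-p / (x : ℂ)) / (Complex.exp (x : ℂ) - 1) *
        ((besselJ (μ - 1 / 2) (r * x) : ℝ) : ℂ)

/-- The `p`-extended Mathieu series `S_{μ,p}(r)`: its defining power series for `|r| < 1`.
For `r ≥ 1` the power series diverges, and `S_{μ,p}(r)` is the continuation of its sum along
the positive half-line, given by the integral. -/
noncomputable def mathieuExt (μ : ℝ) (p : ℂ) (r : ℝ) : ℂ :=
  if |r| < 1 then mathieuPowerSeries μ p r else mathieuIntegral μ p r

end ExtMathieu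

namespace ExtMathieu

open Filter Topology

/-! Both formulas come from one device: the Mellin transform of a multiplicative convolution `∫
k(rx) h(x) dx` is the Mellin transform of `k` at `s` times `∫ x^(-s) h(x) dx`
(`hasMellin_integral_comp_mul`).

For the transform in `p`, substituting `u = 1/x` makes `ζ_p(α)` a convolution with kernel `e^(-t)`,
so its transform is an explicit product of Gamma and zeta values (`hasMellin_zetaExt`). The defining
series is then integrated term by term. This is legitimate because `ζ_p(α) ≥ 0` for real `p`, so the
integrals of the norms are explicit too, and for `|r| < 1` they are summable by the ratio test.

For the transform in `r`, let `K_μ(y) = (y/2)^(1/2-μ) J_(μ-1/2)(y)` and `w(x) = e^(-p/x)/(e^x-1)`.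
Up to a constant, `S_{μ,p}(r)` equals `∫ x^(2μ) K_μ(rx) w(x) dx` for all `r > 0` (`mathieuExt_eq`),
again a convolution. As `K_μ(y) = O(y^(-μ))`, applying the device directly would only reach `Re s <
μ`. One integration by parts replaces `K_μ` by `K_(μ+1)` and `w` by `w'`
(`mathieuExt_eq_integral_deriv`), which widens the strip to `Re s < μ+1`. The transform of `K_μ`
itself is found by convolving it with a Gaussian (`mellin_besselKernel`), and Legendre duplication
assembles the Beta function. -/

/-! ### The Bessel–Clifford function: convergence, derivative, recurrence. -/

/-- `∑ (-z)^n / (n! Γ(n+ν+1))`, the Bessel–Clifford function of order `ν` at `-z`. -/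
noncomputable def besselClifford (ν z : ℝ) : ℝ :=
  ∑' n : ℕ, (-z) ^ n / ((n.factorial : ℝ) * Real.Gamma (n + ν + 1))

theorem summable_besselClifford {ν : ℝ} (hν : -1 < ν) (z : ℝ) :
    Summable fun n : ℕ => (-z) ^ n / ((n.factorial : ℝ) * Real.Gamma (n + ν + 1)) := by
  have hev : ∀ᶠ n : ℕ in atTop, 2 * |z| ≤ n + ν + 1 := by
    filter_upwards [eventually_ge_atTop ⌈2 * |z|⌉₊] with n hn
    have := Nat.ceil_le.1 hn
    linarith
  refine summable_of_ratio_norm_eventually_le (r := 1 / 2) (by norm_num) ?_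
  filter_upwards [hev] with n hn
  have h0 : 0 < (n : ℝ) + ν + 1 := by have : (0 : ℝ) ≤ n := n.cast_nonneg; linarith
  have hG := Real.Gamma_pos_of_pos h0
  have hf : (0 : ℝ) < n.factorial := by exact_mod_cast n.factorial_pos
  have e : (((n + 1 : ℕ) : ℝ) + ν + 1) = (n + ν + 1) + 1 := by push_cast; ring
  have hD : 0 < ((n + 1 : ℕ) : ℝ) * n.factorial * ((n + ν + 1) * Real.Gamma (n + ν + 1)) := by
    positivity
  rw [e, Real.Gamma_add_one h0.ne', Nat.factorial_succ, Nat.cast_mul, pow_succ, norm_div, norm_div,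
    norm_mul _ (-z), norm_neg z, Real.norm_of_nonneg hD.le, Real.norm_of_nonneg (mul_pos hf hG).le,
    Real.norm_eq_abs z]
  have h1 : |z| / (((n + 1 : ℕ) : ℝ) * (n + ν + 1)) ≤ 1 / 2 := by
    rw [div_le_iff₀ (by positivity)]
    have : (n + ν + 1) ≤ ((n + 1 : ℕ) : ℝ) * (n + ν + 1) := by
      push_cast
      nlinarith [(n.cast_nonneg : (0 : ℝ) ≤ n)]
    linarith
  calc _ = |z| / (((n + 1 : ℕ) : ℝ) * (n + ν + 1)) *
        (‖(-z) ^ n‖ / ((n.factorial : ℝ) * Real.Gamma (n + ν + 1))) := by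
        push_cast; field_simp
    _ ≤ _ := by gcongr

/-- Termwise differentiation shifts the index by one, which raises the order. On the ball of radius
`R = |z| + 1` the differentiated terms are dominated by those of the order `ν + 1` series at `-R`,
whose terms are positive. -/
theorem hasDerivAt_besselClifford {ν : ℝ} (hν : -1 < ν) (z : ℝ) :
    HasDerivAt (besselClifford ν) (-besselClifford (ν + 1) z) z := by
  set R := |z| + 1
  have hR : 0 < R := by positivity
  have hterm (n : ℕ) (y : ℝ) :
      HasDerivAt (fun z : ℝ => (-z) ^ n / ((n.factorial : ℝ) * Real.Gamma (n + ν + 1)))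
        (-(n * (-y) ^ (n - 1)) / ((n.factorial : ℝ) * Real.Gamma (n + ν + 1))) y := by
    have := ((hasDerivAt_id y).neg.pow n).div_const ((n.factorial : ℝ) * Real.Gamma (n + ν + 1))
    simpa using this
  have hshift (n : ℕ) (y : ℝ) : -((n + 1 : ℕ) * y ^ (n + 1 - 1)) /
      (((n + 1).factorial : ℝ) * Real.Gamma ((n + 1 : ℕ) + ν + 1)) =
      -(y ^ n / ((n.factorial : ℝ) * Real.Gamma (n + (ν + 1) + 1))) := by
    have hf : (n.factorial : ℝ) ≠ 0 := by exact_mod_cast n.factorial_ne_zero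
    have hn : ((n : ℝ) + 1) ≠ 0 := by positivity
    have e : (((n + 1 : ℕ) : ℝ) + ν + 1) = n + (ν + 1) + 1 := by push_cast; ring
    rw [e, Nat.factorial_succ, Nat.add_sub_cancel]
    push_cast
    rw [neg_div, mul_assoc, mul_div_mul_left _ _ hn]
  have hG (n : ℕ) : 0 < Real.Gamma (n + ν + 1) :=
    Real.Gamma_pos_of_pos (by have : (0 : ℝ) ≤ n := n.cast_nonneg; linarith)
  have hu : Summable fun n : ℕ =>
      n * R ^ (n - 1) / ((n.factorial : ℝ) * Real.Gamma (n + ν + 1)) := by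
    rw [← summable_nat_add_iff 1]
    have := summable_besselClifford (ν := ν + 1) (by linarith) (-R)
    refine this.congr fun n => ?_
    rw [neg_neg, ← neg_inj, ← hshift, ← neg_div]
  have hz : z ∈ Metric.ball (0 : ℝ) R := by simp [R]
  have key := hasDerivAt_tsum_of_isPreconnected hu Metric.isOpen_ball
    (convex_ball (0 : ℝ) R).isPreconnected (fun n y _ => hterm n y)
    (fun n y hy => ?_) hz (summable_besselClifford hν z) hz
  · convert! key using 1
    rw [Summable.tsum_eq_zero_add]
    · simp only [hshift, tsum_neg]
      simp [besselClifford]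
    · rw [← summable_nat_add_iff 1]
      simp only [hshift]
      exact (summable_besselClifford (by linarith) z).neg
  · have hy' : |y| ≤ R := by simpa using (mem_ball_zero_iff.1 hy).le
    have hf : (0 : ℝ) < n.factorial := by exact_mod_cast n.factorial_pos
    have := hG n
    rw [norm_div, norm_neg, norm_mul, norm_pow, norm_neg, Real.norm_natCast,
      Real.norm_of_nonneg (by positivity : 0 ≤ (n.factorial : ℝ) * Real.Gamma (n + ν + 1)),
      Real.norm_eq_abs]
    gcongr

theorem continuous_besselClifford {ν : ℝ} (hν : -1 < ν) : Continuous (besselClifford ν) :=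
  continuous_iff_continuousAt.2 fun z => (hasDerivAt_besselClifford hν z).continuousAt

/-- Write `1/Γ(n+ν+1) = ((ν+1) + n)/Γ(n+ν+2)`; the part carrying the factor `n` has zero first term
and reindexes to the series of order `ν + 2`. -/
theorem besselClifford_recurrence {ν : ℝ} (hν : -1 < ν) (z : ℝ) :
    besselClifford ν z = (ν + 1) * besselClifford (ν + 1) z - z * besselClifford (ν + 2) z := by
  have s1 := (summable_besselClifford (ν := ν + 1) (by linarith) z).hasSum
  have s2 := (summable_besselClifford (ν := ν + 2) (by linarith) z).hasSum
  have h2 : HasSum (fun n : ℕ => n * ((-z) ^ n /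
      ((n.factorial : ℝ) * Real.Gamma (n + (ν + 1) + 1)))) (-z * besselClifford (ν + 2) z) := by
    rw [← hasSum_nat_add_iff' 1]
    have := s2.mul_left (-z)
    simp only [Finset.range_one, Finset.sum_singleton, Nat.cast_zero, zero_mul, sub_zero]
    convert! this using 2 with n
    have hn : ((n : ℝ) + 1) ≠ 0 := by positivity
    have e : (((n + 1 : ℕ) : ℝ) + (ν + 1) + 1) = n + (ν + 2) + 1 := by push_cast; ring
    rw [e, Nat.factorial_succ]
    push_cast
    rw [mul_assoc, ← div_div, mul_div_assoc', mul_div_assoc', mul_div_cancel_left₀ _ hn, pow_succ]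
    ring
  have h := (s1.mul_left (ν + 1)).add h2
  rw [besselClifford, sub_eq_add_neg, ← neg_mul]
  refine HasSum.tsum_eq ?_
  convert! h using 2 with n
  have h0 : 0 < (n : ℝ) + ν + 1 := by have : (0 : ℝ) ≤ n := n.cast_nonneg; linarith
  have hG := Real.Gamma_pos_of_pos h0
  have e : (n : ℝ) + (ν + 1) + 1 = (n + ν + 1) + 1 := by ring
  rw [e, Real.Gamma_add_one h0.ne', ← add_mul]
  have hf : (0 : ℝ) < n.factorial := by exact_mod_cast n.factorial_pos
  field_simp
  ring

/-! ### The normalised Bessel kernel and its decay. -/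

/-- The entire function `(y/2)^(1/2-μ) J_(μ-1/2)(y)`. -/
noncomputable def besselKernel (μ y : ℝ) : ℝ :=
  besselClifford (μ - 1 / 2) (y ^ 2 / 4)

theorem continuous_besselKernel {μ : ℝ} (hμ : 0 < μ) : Continuous (besselKernel μ) :=
  (continuous_besselClifford (by linarith)).comp (by fun_prop)

theorem hasDerivAt_besselKernel {μ : ℝ} (hμ : 0 < μ) (y : ℝ) :
    HasDerivAt (besselKernel μ) (-(y / 2) * besselKernel (μ + 1) y) y := by
  have h := (hasDerivAt_besselClifford (ν := μ - 1 / 2) (by linarith) (y ^ 2 / 4)).comp y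
    (((hasDerivAt_id y).pow 2).div_const 4)
  convert! h using 1
  simp [besselKernel]
  ring_nf

theorem besselKernel_recurrence {μ : ℝ} (hμ : 0 < μ) (y : ℝ) :
    besselKernel μ y =
      (μ + 1 / 2) * besselKernel (μ + 1) y - y ^ 2 / 4 * besselKernel (μ + 2) y := by
  have h := besselClifford_recurrence (ν := μ - 1 / 2) (by linarith) (y ^ 2 / 4)
  have e : μ + 1 - 1 / 2 = μ - 1 / 2 + 1 := by ring
  have e' : μ + 2 - 1 / 2 = μ - 1 / 2 + 2 := by ring
  have e'' : μ + 1 / 2 = μ - 1 / 2 + 1 := by ring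
  rw [besselKernel, besselKernel, besselKernel, e, e', e'', h]

/-- This is the classical `J(y) = O(y^(-1/2))`. No asymptotic expansion is needed: `u` and `v`
satisfy `u' = (μ/y)u - v`, `v' = u - (μ/y)v`, a perturbed rotation, and a corrected energy
decreases. -/
theorem exists_rpow_mul_besselKernel_bound {μ : ℝ} (hμ : 0 < μ) :
    ∃ C, ∀ y, 2 * μ ≤ y → y ^ μ * |besselKernel μ y| ≤ C := by
  set u : ℝ → ℝ := fun y => y ^ μ * besselKernel μ y
  set v : ℝ → ℝ := fun y => y ^ (μ + 1) * besselKernel (μ + 1) y / 2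
  have hu (y : ℝ) (hy : 0 < y) : HasDerivAt u (μ / y * u y - v y) y := by
    convert! (Real.hasDerivAt_rpow_const (p := μ) (Or.inl hy.ne')).mul
      (hasDerivAt_besselKernel hμ y) using 1
    simp only [u, v, Real.rpow_add_one hy.ne', Real.rpow_sub_one hy.ne']
    field_simp
    ring
  have hv (y : ℝ) (hy : 0 < y) : HasDerivAt v (-(μ / y) * v y + u y) y := by
    convert! ((Real.hasDerivAt_rpow_const (p := μ + 1) (Or.inl hy.ne')).mul
      (hasDerivAt_besselKernel (μ := μ + 1) (by linarith) y)).div_const 2 using 1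
    have e : μ + 1 + 1 = μ + 2 := by ring
    simp only [u, v, Real.rpow_add_one hy.ne', besselKernel_recurrence hμ y,
      add_sub_cancel_right, e]
    field_simp
    ring
  -- Since `(u² + v²)' = (2μ/y)(u² - v²)` and `(uv)' = u² - v²`, subtracting `(2μ/y)uv` leaves only
  -- the derivative `(2μ/y²)uv`. The exponential factor absorbs this error once `2μ/y ≤ 1`.
  set E : ℝ → ℝ := fun y => (u y ^ 2 + v y ^ 2 - 2 * μ / y * (u y * v y)) * Real.exp (2 * μ / y)
  have hE (y : ℝ) (hy : 0 < y) : HasDerivAt E (-(2 * μ / y ^ 2) *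
      (u y ^ 2 + v y ^ 2 - (1 + 2 * μ / y) * (u y * v y)) * Real.exp (2 * μ / y)) y := by
    have hd : HasDerivAt (fun y : ℝ => 2 * μ / y) (-(2 * μ) / y ^ 2) y := by
      convert! (hasDerivAt_const y (2 * μ)).div (hasDerivAt_id y) hy.ne' using 1
      simp
    convert! ((((hu y hy).pow 2).add ((hv y hy).pow 2)).sub
      (hd.mul ((hu y hy).mul (hv y hy)))).mul hd.exp using 1
    simp only [Pi.add_apply, Pi.mul_apply, Pi.pow_apply, Pi.sub_apply]
    field_simp
    ring
  have hanti : AntitoneOn E (Ici (2 * μ)) := by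
    refine antitoneOn_of_deriv_nonpos (convex_Ici _)
      (fun y hy => (hE y (lt_of_lt_of_le (by linarith) hy)).continuousAt.continuousWithinAt)
      (fun y hy => ?_) (fun y hy => ?_)
    all_goals
      rw [interior_Ici, mem_Ioi] at hy
      have hy0 : 0 < y := by linarith
    · exact (hE y hy0).differentiableAt.differentiableWithinAt
    · rw [(hE y hy0).deriv]
      have ht1 : 2 * μ / y ≤ 1 := (div_le_one hy0).2 hy.le
      have ht0 : 0 < 2 * μ / y := by positivity
      have hq : 0 ≤ u y ^ 2 + v y ^ 2 - (1 + 2 * μ / y) * (u y * v y) := by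
        nlinarith [sq_nonneg (u y - v y), sq_nonneg (u y + v y)]
      have : 0 ≤ 2 * μ / y ^ 2 * (u y ^ 2 + v y ^ 2 - (1 + 2 * μ / y) * (u y * v y)) *
        Real.exp (2 * μ / y) := by positivity
      linarith
  refine ⟨√(2 * E (2 * μ)), fun y hy => Real.le_sqrt_of_sq_le ?_⟩
  have hy0 : 0 < y := by linarith
  have ht1 : 2 * μ / y ≤ 1 := (div_le_one hy0).2 hy
  have ht0 : 0 < 2 * μ / y := by positivity
  have h1 : E y ≤ E (2 * μ) := hanti self_mem_Ici hy hy
  have h2 : u y ^ 2 + v y ^ 2 ≤ 2 * (u y ^ 2 + v y ^ 2 - 2 * μ / y * (u y * v y)) := by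
    nlinarith [sq_nonneg (u y - v y), sq_nonneg (u y + v y)]
  have h3 : u y ^ 2 + v y ^ 2 - 2 * μ / y * (u y * v y) ≤ E y :=
    le_mul_of_one_le_right (by nlinarith [sq_nonneg (u y), sq_nonneg (v y)])
      (Real.one_le_exp ht0.le)
  have h4 : (y ^ μ * |besselKernel μ y|) ^ 2 = u y ^ 2 := by
    simp only [u, mul_pow, sq_abs]
  rw [h4]
  nlinarith [sq_nonneg (v y)]

theorem exists_besselKernel_bound {μ : ℝ} (hμ : 0 < μ) :
    ∃ C, 0 ≤ C ∧ ∀ y, 0 < y → |besselKernel μ y| ≤ C ∧ |besselKernel μ y| ≤ C * y ^ (-μ) := by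
  obtain ⟨A, hA⟩ := exists_rpow_mul_besselKernel_bound hμ
  obtain ⟨B, hB⟩ := (isCompact_Icc (a := 0) (b := max 1 (2 * μ))).exists_bound_of_continuousOn
    (continuous_besselKernel hμ).continuousOn
  set m := max 1 (2 * μ)
  have hm : 1 ≤ m := le_max_left _ _
  have hB0 : 0 ≤ B := (norm_nonneg _).trans (hB 0 ⟨le_rfl, by linarith⟩)
  have hmμ : 1 ≤ m ^ μ := Real.one_le_rpow hm hμ.le
  refine ⟨max A (B * m ^ μ), le_max_of_le_right (by positivity), fun y hy => ?_⟩
  have hyμ : 0 < y ^ μ := Real.rpow_pos_of_pos hy μ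
  rw [Real.rpow_neg hy.le, ← div_eq_mul_inv, le_div_iff₀ hyμ]
  rcases le_or_gt y m with h | h
  · have hb : |besselKernel μ y| ≤ B := hB y ⟨hy.le, h⟩
    have hle : y ^ μ ≤ m ^ μ := Real.rpow_le_rpow hy.le h hμ.le
    exact ⟨le_max_of_le_right (hb.trans (le_mul_of_one_le_right hB0 hmμ)),
      le_max_of_le_right (mul_le_mul hb hle hyμ.le hB0)⟩
  · have ha := hA y ((le_max_right _ _).trans h.le)
    have h1 : 1 ≤ y ^ μ := Real.one_le_rpow (hm.trans h.le) hμ.le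
    refine ⟨le_max_of_le_left (le_trans ?_ ha), le_max_of_le_left (by rwa [mul_comm])⟩
    exact le_mul_of_one_le_left (abs_nonneg _) h1

theorem mellinConvergent_besselKernel {μ : ℝ} (hμ : 0 < μ) {s : ℂ} (hs : 0 < s.re)
    (hs' : s.re < μ) : MellinConvergent (fun y => (besselKernel μ y : ℂ)) s := by
  obtain ⟨C, -, hC⟩ := exists_besselKernel_bound hμ
  refine mellinConvergent_of_isBigO_rpow (a := μ) (b := 0) ?_ ?_ hs' ?_ hs
  · exact ((Complex.continuous_ofReal.comp
      (continuous_besselKernel hμ)).locallyIntegrable).locallyIntegrableOn _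
  · refine Asymptotics.IsBigO.of_bound C ?_
    filter_upwards [eventually_gt_atTop 0] with y hy
    rw [Complex.norm_real, Real.norm_eq_abs, Real.norm_of_nonneg (Real.rpow_nonneg hy.le _)]
    exact (hC y hy).2
  · refine Asymptotics.IsBigO.of_bound C ?_
    filter_upwards [self_mem_nhdsWithin] with y hy
    rw [Complex.norm_real, Real.norm_eq_abs]
    simpa using (hC y hy).1

/-- Exhibits `x^(2μ) K_μ(rx)` as a derivative, which drives the later integration by parts. -/
theorem hasDerivAt_rpow_mul_besselKernel {μ : ℝ} (hμ : 0 < μ) (r : ℝ) {x : ℝ} (hx : 0 < x) :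
    HasDerivAt (fun x => x ^ (2 * μ + 1) * besselKernel (μ + 1) (r * x))
      (2 * x ^ (2 * μ) * besselKernel μ (r * x)) x := by
  have h := (hasDerivAt_besselKernel (μ := μ + 1) (by linarith) (r * x)).comp x
    ((hasDerivAt_id x).const_mul r)
  convert! (Real.hasDerivAt_rpow_const (p := 2 * μ + 1) (Or.inl hx.ne')).mul h using 1
  have e : μ + 1 + 1 = μ + 2 := by ring
  rw [besselKernel_recurrence hμ, e, add_sub_cancel_right, Real.rpow_add_one hx.ne']
  simp
  ring

/-! ### Interchange of integrals, and of sum and integral. -/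

/-- The Mellin transform of a multiplicative convolution. -/
theorem hasMellin_integral_comp_mul {k h : ℝ → ℂ} {s : ℂ} (hk : Continuous k)
    (hks : MellinConvergent k s) (hh : ContinuousOn h (Ioi 0))
    (hhs : IntegrableOn (fun x : ℝ => (x : ℂ) ^ (-s) * h x) (Ioi 0)) :
    HasMellin (fun r : ℝ => ∫ x in Ioi (0 : ℝ), k (r * x) * h x) s
      (mellin k s * ∫ x in Ioi (0 : ℝ), (x : ℂ) ^ (-s) * h x) := by
  have hks' (x : ℝ) (hx : 0 < x) :
      IntegrableOn (fun r : ℝ => (r : ℂ) ^ (s - 1) * (k (r * x) * h x)) (Ioi 0) := by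
    have := (MellinConvergent.comp_mul_left (f := k) (s := s) hx).2 hks
    simp only [MellinConvergent, smul_eq_mul, mul_comm x] at this
    simpa only [mul_assoc] using! this.mul_const (h x)
  have hval (x : ℝ) (hx : 0 < x) :
      ∫ r in Ioi (0 : ℝ), (r : ℂ) ^ (s - 1) * (k (r * x) * h x) =
        mellin k s * ((x : ℂ) ^ (-s) * h x) := by
    have := mellin_comp_mul_left k s hx
    simp only [mellin, smul_eq_mul, mul_comm x] at this ⊢
    simp only [← mul_assoc, integral_mul_const]
    simp only [mul_assoc] at this ⊢
    rw [this]
    ring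
  -- Scaling makes the inner integral of norms a constant times `‖x^(-s) h(x)‖`, so Fubini's
  -- hypothesis reduces to the integrability of that function.
  have hnorm (x : ℝ) (hx : 0 < x) :
      ∫ r in Ioi (0 : ℝ), ‖(r : ℂ) ^ (s - 1) * (k (r * x) * h x)‖ =
        (∫ r in Ioi (0 : ℝ), ‖(r : ℂ) ^ (s - 1) * k r‖) * ‖(x : ℂ) ^ (-s) * h x‖ := by
    have h1 := integral_comp_mul_left_Ioi (fun r : ℝ => ‖(r : ℂ) ^ (s - 1) * k r‖) 0 hx
    rw [mul_zero, smul_eq_mul, inv_mul_eq_div, eq_div_iff hx.ne'] at h1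
    rw [← h1, mul_assoc, ← integral_mul_const]
    refine setIntegral_congr_fun measurableSet_Ioi fun r hr => ?_
    have hr : 0 < r := hr
    have hxr : 0 < x * r := mul_pos hx hr
    simp only [norm_mul, Complex.norm_cpow_eq_rpow_re_of_pos hr,
      Complex.norm_cpow_eq_rpow_re_of_pos hxr, Complex.norm_cpow_eq_rpow_re_of_pos hx,
      Real.mul_rpow hx.le hr.le, Complex.sub_re, Complex.one_re, Complex.neg_re, mul_comm r x]
    rw [Real.rpow_sub_one hx.ne', Real.rpow_neg hx.le]
    have := Real.rpow_pos_of_pos hx s.re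
    field_simp
  have hmeas : AEStronglyMeasurable
      (Function.uncurry fun r x : ℝ => (r : ℂ) ^ (s - 1) * (k (r * x) * h x))
      ((volume.restrict (Ioi 0)).prod (volume.restrict (Ioi 0))) := by
    rw [Measure.prod_restrict]
    refine ContinuousOn.aestronglyMeasurable ?_ (measurableSet_Ioi.prod measurableSet_Ioi)
    refine ContinuousOn.mul ?_ (ContinuousOn.mul ?_ ?_)
    · intro z hz
      exact ((Complex.continuousAt_ofReal_cpow_const z.1 (s - 1)
        (Or.inr (ne_of_gt hz.1))).comp continuousAt_fst).continuousWithinAt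
    · exact (hk.comp (by fun_prop)).continuousOn
    · exact hh.comp continuousOn_snd fun z hz => hz.2
  have hint : Integrable
      (Function.uncurry fun r x : ℝ => (r : ℂ) ^ (s - 1) * (k (r * x) * h x))
      ((volume.restrict (Ioi 0)).prod (volume.restrict (Ioi 0))) := by
    rw [integrable_prod_iff' hmeas]
    refine ⟨(ae_restrict_iff' measurableSet_Ioi).2 (ae_of_all _ fun x hx => hks' x hx), ?_⟩
    refine IntegrableOn.congr_fun ?_ (fun x hx => (hnorm x hx).symm) measurableSet_Ioi
    exact hhs.norm.const_mul _
  refine ⟨?_, ?_⟩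
  · simpa [MellinConvergent, Function.uncurry, integral_const_mul] using! hint.integral_prod_left
  · simp only [mellin, smul_eq_mul]
    simp only [← integral_const_mul]
    rw [integral_integral_swap hint]
    refine setIntegral_congr_fun measurableSet_Ioi fun x hx => ?_
    simpa [mellin] using hval x hx

/-- Supplies the existence half of the Mellin transform in `p`. Pointwise summability makes the sum
an a.e. limit of its partial sums, hence measurable. -/
theorem integrable_tsum_of_summable_integral_norm {α : Type*} [MeasurableSpace α] {m : Measure α}
    {F : ℕ → α → ℂ} (hF : ∀ n, Integrable (F n) m)
    (hsum : Summable fun n => ∫ a, ‖F n a‖ ∂m) (hF' : ∀ᵐ a ∂m, Summable fun n => F n a) :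
    Integrable (fun a => ∑' n, F n a) m := by
  refine ⟨?_, ?_⟩
  · refine aestronglyMeasurable_of_tendsto_ae atTop
      (f := fun N a => ∑ n ∈ Finset.range N, F n a) (fun N => ?_) ?_
    · exact Finset.aestronglyMeasurable_fun_sum _ fun n _ => (hF n).1
    · filter_upwards [hF'] with a ha using ha.hasSum.tendsto_sum_nat
  · have h1 : ∑' n, ∫⁻ a, ‖F n a‖ₑ ∂m < ⊤ := by
      have (n : ℕ) : ∫⁻ a, ‖F n a‖ₑ ∂m = ENNReal.ofReal (∫ a, ‖F n a‖ ∂m) :=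
        (ofReal_integral_norm_eq_lintegral_enorm (hF n)).symm
      rw [funext this]
      exact hsum.tsum_ofReal_lt_top
    rw [← lintegral_tsum fun n => (hF n).1.enorm] at h1
    refine lt_of_le_of_lt (lintegral_mono fun a => ?_) h1
    exact enorm_tsum_le_tsum_enorm

/-! ### The weight: decay at both ends and Mellin transform. -/

/-- The weight `e^(-p/x) / (e^x - 1)`. -/
noncomputable def boseWeight (p : ℂ) (x : ℝ) : ℂ :=
  Complex.exp (-p / (x : ℂ)) / (Complex.exp (x : ℂ) - 1)

theorem norm_boseWeight (p : ℂ) {x : ℝ} (hx : 0 < x) :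
    ‖boseWeight p x‖ = Real.exp (-p.re / x) / (Real.exp x - 1) := by
  have h : 0 < Real.exp x - 1 := by linarith [Real.add_one_le_exp x]
  rw [boseWeight, norm_div, Complex.norm_exp, ← Complex.ofReal_exp, ← Complex.ofReal_one,
    ← Complex.ofReal_sub, Complex.norm_of_nonneg h.le, Complex.div_ofReal_re, Complex.neg_re]

theorem exp_sub_one_ne_zero {x : ℝ} (hx : 0 < x) : Complex.exp (x : ℂ) - 1 ≠ 0 := by
  have h : 0 < Real.exp x - 1 := by linarith [Real.add_one_le_exp x]
  exact_mod_cast h.ne'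

theorem hasDerivAt_boseWeight (p : ℂ) {x : ℝ} (hx : 0 < x) :
    HasDerivAt (boseWeight p)
      (boseWeight p x * (p / (x : ℂ) ^ 2 - 1 - 1 / (Complex.exp (x : ℂ) - 1))) x := by
  have hx' : (x : ℂ) ≠ 0 := by exact_mod_cast hx.ne'
  have h0 := exp_sub_one_ne_zero hx
  have h1 : HasDerivAt (fun z : ℂ => -p / z) (p / (x : ℂ) ^ 2) x := by
    convert! (hasDerivAt_const (x : ℂ) (-p)).div (hasDerivAt_id (x : ℂ)) hx' using 1
    simp
  convert! (h1.cexp.div ((Complex.hasDerivAt_exp (x : ℂ)).sub_const 1) h0).comp_ofReal using 1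
  rw [boseWeight]
  field_simp
  ring

theorem continuousOn_boseWeight (p : ℂ) : ContinuousOn (boseWeight p) (Ioi 0) :=
  fun _ hx => (hasDerivAt_boseWeight p hx).continuousAt.continuousWithinAt

theorem exists_rpow_mul_norm_boseWeight_bound {p : ℂ} (hp : 0 < p.re) (b : ℝ) :
    ∃ C, ∀ x, 0 < x → x ^ b * ‖boseWeight p x‖ ≤ C := by
  -- Near `0`, `e^(-Re p/x) ≤ N! (x/Re p)^N` and `1/(e^x-1) ≤ 1/x`, so `b + N - 1 ≥ 0` suffices. For
  -- `x > 1`, the Taylor term of degree `n + 1` of `e^x` beats `x^b`.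
  obtain ⟨N, hN⟩ := exists_nat_ge (1 - b)
  obtain ⟨n, hn⟩ := exists_nat_ge b
  set A : ℝ := N.factorial / p.re ^ N
  have hA : 0 ≤ A := by positivity
  refine ⟨max A ((n + 1).factorial), fun x hx => ?_⟩
  have he : 0 < Real.exp x - 1 := by linarith [Real.add_one_le_exp x]
  rw [norm_boseWeight p hx]
  rcases le_or_gt x 1 with h | h
  · refine le_max_of_le_left ?_
    have h1 : Real.exp (-p.re / x) ≤ A * x ^ N := by
      have := Real.pow_div_factorial_le_exp (x := p.re / x) (by positivity) N
      rw [neg_div, Real.exp_neg]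
      refine (inv_anti₀ (by positivity) this).trans (le_of_eq ?_)
      rw [div_pow, div_div, inv_div]
      simp only [A]
      ring
    have h2 : Real.exp (-p.re / x) / (Real.exp x - 1) ≤ A * x ^ N / x :=
      div_le_div₀ (by positivity) h1 hx (by linarith [Real.add_one_le_exp x])
    calc x ^ b * (Real.exp (-p.re / x) / (Real.exp x - 1)) ≤ x ^ b * (A * x ^ N / x) := by gcongr
      _ = A * x ^ (b + N - 1) := by
        rw [Real.rpow_sub_one hx.ne', Real.rpow_add hx, Real.rpow_natCast]; ring
      _ ≤ A * 1 := by gcongr; exact Real.rpow_le_one hx.le h (by linarith)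
      _ = A := mul_one A
  · refine le_max_of_le_right ?_
    have h1 : Real.exp (-p.re / x) ≤ 1 := Real.exp_le_one_iff.2 (by
      rw [neg_div]; exact neg_nonpos.2 (by positivity))
    have h2 : x ^ n * x / (n + 1).factorial ≤ Real.exp x - 1 := by
      have := Real.sum_le_exp_of_nonneg hx.le (n + 2)
      rw [Finset.sum_range_succ] at this
      have h3 : 1 ≤ ∑ i ∈ Finset.range (n + 1), x ^ i / (i.factorial : ℝ) := by
        rw [Finset.sum_range_succ']
        simp only [pow_zero, Nat.factorial_zero, Nat.cast_one, div_one, le_add_iff_nonneg_left]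
        positivity
      rw [← pow_succ]
      linarith
    rw [mul_div_assoc', div_le_iff₀ he]
    have h4 : x ^ b ≤ x ^ n := by
      rw [← Real.rpow_natCast]; exact Real.rpow_le_rpow_of_exponent_le h.le hn
    have h5 : x ^ n ≤ (n + 1).factorial * (Real.exp x - 1) := by
      rw [div_le_iff₀ (by positivity)] at h2
      have : x ^ n ≤ x ^ n * x := le_mul_of_one_le_right (by positivity) h.le
      linarith
    calc x ^ b * Real.exp (-p.re / x) ≤ x ^ n * 1 := by gcongr
      _ ≤ _ := by linarith

theorem tendsto_rpow_mul_norm_boseWeight {p : ℂ} (hp : 0 < p.re) (b : ℝ) :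
    Tendsto (fun x => x ^ b * ‖boseWeight p x‖) (𝓝[>] 0) (𝓝 0) ∧
      Tendsto (fun x => x ^ b * ‖boseWeight p x‖) atTop (𝓝 0) := by
  obtain ⟨C, hC⟩ := exists_rpow_mul_norm_boseWeight_bound hp (b - 1)
  obtain ⟨D, hD⟩ := exists_rpow_mul_norm_boseWeight_bound hp (b + 1)
  constructor
  · have h0 : Tendsto (fun x : ℝ => C * x) (𝓝[>] 0) (𝓝 0) := by
      have : Tendsto (fun x : ℝ => C * x) (𝓝 0) (𝓝 (C * 0)) := tendsto_id.const_mul C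
      rw [mul_zero] at this
      exact this.mono_left nhdsWithin_le_nhds
    refine squeeze_zero' ?_ ?_ h0
    · filter_upwards [self_mem_nhdsWithin] with x hx
      have : 0 < x := hx
      positivity
    · filter_upwards [self_mem_nhdsWithin] with x hx
      have hx : 0 < x := hx
      have h := hC x hx
      rw [Real.rpow_sub_one hx.ne', div_mul_eq_mul_div, div_le_iff₀ hx] at h
      exact h
  · have h0 : Tendsto (fun x : ℝ => D / x) atTop (𝓝 0) := tendsto_const_nhds.div_atTop tendsto_id
    refine squeeze_zero' ?_ ?_ h0
    · filter_upwards [eventually_gt_atTop 0] with x hx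
      positivity
    · filter_upwards [eventually_gt_atTop 0] with x hx
      have h := hD x hx
      rw [Real.rpow_add_one hx.ne'] at h
      rw [le_div_iff₀ hx]
      linarith

theorem mellinConvergent_boseWeight {p : ℂ} (hp : 0 < p.re) (s : ℂ) :
    MellinConvergent (boseWeight p) s := by
  obtain ⟨C, hC⟩ := exists_rpow_mul_norm_boseWeight_bound hp (s.re - 1)
  obtain ⟨D, hD⟩ := exists_rpow_mul_norm_boseWeight_bound hp (s.re + 1)
  refine mellinConvergent_of_isBigO_rpow (a := s.re + 1) (b := s.re - 1)
    ((continuousOn_boseWeight p).locallyIntegrableOn measurableSet_Ioi) ?_ (by linarith) ?_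
    (by linarith)
  · refine Asymptotics.IsBigO.of_bound D ?_
    filter_upwards [eventually_gt_atTop 0] with x hx
    have := hD x hx
    rw [Real.norm_of_nonneg (by positivity), Real.rpow_neg hx.le, ← div_eq_mul_inv,
      le_div_iff₀ (by positivity)]
    linarith
  · refine Asymptotics.IsBigO.of_bound C ?_
    filter_upwards [self_mem_nhdsWithin] with x hx
    have hx : 0 < x := hx
    have := hC x hx
    rw [Real.norm_of_nonneg (by positivity), Real.rpow_neg hx.le, ← div_eq_mul_inv,
      le_div_iff₀ (by positivity)]
    linarith

/-- Expand `1/(e^t - 1)` as the geometric series of `e^(-(n+1)t)` and integrate termwise. -/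
theorem hasMellin_boseWeight_zero {a : ℂ} (ha : 1 < a.re) :
    HasMellin (boseWeight 0) a (Complex.Gamma a * riemannZeta a) := by
  have key {a : ℂ} (ha : 1 < a.re) :
      mellin (boseWeight 0) a = Complex.Gamma a * riemannZeta a := by
    have h := hasSum_mellin (a := fun _ : ℕ => 1) (p := fun n : ℕ => n + 1) (F := boseWeight 0)
      (s := a) (fun n => Or.inr (by positivity)) (by linarith) (fun t ht => ?_) ?_
    · rw [← h.tsum_eq, zeta_eq_tsum_one_div_nat_add_one_cpow ha, ← tsum_mul_left]
      refine tsum_congr fun n => ?_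
      push_cast
      ring
    · have ht : 0 < t := ht
      have hlt : Real.exp (-t) < 1 := Real.exp_lt_one_iff.2 (by linarith)
      have hg := ((hasSum_geometric_of_lt_one (Real.exp_pos _).le hlt).mul_left
        (Real.exp (-t))).mapL Complex.ofRealCLM
      convert! hg using 1
      · ext n
        rw [one_mul]
        simp only [Complex.ofRealCLM_apply]
        rw [← Real.exp_nat_mul, ← Real.exp_add]
        congr 2
        ring
      · have h0 := exp_sub_one_ne_zero ht
        have hne : (Complex.exp (t : ℂ)) ≠ 0 := Complex.exp_ne_zero _
        simp only [boseWeight, Complex.ofRealCLM_apply]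
        push_cast
        rw [Complex.exp_neg]
        have : 1 - (Complex.exp (t : ℂ))⁻¹ ≠ 0 := by
          rw [sub_ne_zero, ne_comm, Ne, inv_eq_one]
          exact sub_ne_zero.1 h0
        simp only [neg_zero, zero_div, Complex.exp_zero]
        field_simp
    · have := (summable_nat_add_iff 1).2 (Real.summable_one_div_nat_rpow.2 ha)
      simpa using this
  refine ⟨?_, key ha⟩
  -- A non-integrable function has integral `0` by convention, whereas `Γ(Re a) ζ(Re a) ≠ 0`; so the
  -- value already found forces convergence at `Re a`, and hence at `a`, where the norms agree.
  have hre : MellinConvergent (boseWeight 0) (a.re : ℂ) := by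
    by_contra hcon
    have h0 : mellin (boseWeight 0) (a.re : ℂ) = 0 := integral_undef hcon
    rw [key (by simpa using ha)] at h0
    refine mul_ne_zero ?_ ?_ h0
    · exact Complex.Gamma_ne_zero_of_re_pos (by rw [Complex.ofReal_re]; linarith)
    · exact riemannZeta_ne_zero_of_one_le_re (by rw [Complex.ofReal_re]; linarith)
  refine Integrable.mono hre ?_ ?_
  · refine ContinuousOn.aestronglyMeasurable (fun x hx => ?_) measurableSet_Ioi
    exact ((Complex.continuousAt_ofReal_cpow_const x (a - 1) (Or.inr (ne_of_gt hx))).smul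
      (hasDerivAt_boseWeight 0 hx).continuousAt).continuousWithinAt
  · refine (ae_restrict_iff' measurableSet_Ioi).2 (ae_of_all _ fun x hx => le_of_eq ?_)
    simp [Complex.norm_cpow_eq_rpow_re_of_pos hx]

/-! ### Bounds for the zeta values and the series. -/

theorem zetaExt_eq_mellin (p α : ℂ) :
    zetaExt p α = 1 / Complex.Gamma α * mellin (boseWeight p) α := by
  simp [zetaExt, mellin, boseWeight, mul_div_assoc]

theorem exists_norm_riemannZeta_bound {a : ℝ} (ha : 1 < a) :
    ∃ C, 0 ≤ C ∧ ∀ s : ℂ, a ≤ s.re → ‖riemannZeta s‖ ≤ C := by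
  have hs := (summable_nat_add_iff 1).2 (Real.summable_one_div_nat_rpow.2 ha)
  refine ⟨∑' n : ℕ, 1 / ((n + 1 : ℕ) : ℝ) ^ a, tsum_nonneg fun n => by positivity, fun s h => ?_⟩
  rw [zeta_eq_tsum_one_div_nat_add_one_cpow (by linarith)]
  refine tsum_of_norm_bounded hs.hasSum fun n => ?_
  have h0 : (0 : ℝ) < (n + 1 : ℕ) := by positivity
  have e : ((n : ℂ) + 1) = (((n + 1 : ℕ) : ℝ) : ℂ) := by push_cast; ring
  rw [e, norm_div, norm_one, Complex.norm_cpow_eq_rpow_re_of_pos h0]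
  gcongr
  exact_mod_cast Nat.succ_pos n

/-- Consecutive terms have ratio `q n`, which tends to `|r|² < 1`. The case `σ = Re s` controls the
integrated series, `σ = 0` the series at fixed `p`. -/
theorem summable_mathieu_majorant {μ σ r : ℝ} (hμ : 0 < μ) (hσ : 0 ≤ σ) (hr : |r| < 1) :
    Summable fun n : ℕ => |r| ^ (2 * n) *
      (Real.Gamma (μ + n + 1) / (Real.Gamma (n + 1) * Real.Gamma (μ + 1))) *
      (Real.Gamma (2 * μ + 2 * n + 1 + σ) / Real.Gamma (2 * μ + 2 * n + 1)) := by
  set q : ℕ → ℝ := fun n => |r| ^ 2 * ((1 + μ / (n + 1)) *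
    ((1 + σ / (2 * μ + 2 * n + 1)) * (1 + σ / (2 * μ + 2 * n + 2))))
  have hinf (c : ℝ) : Tendsto (fun n : ℕ => 2 * μ + 2 * (n : ℝ) + c) atTop atTop :=
    tendsto_atTop_add_const_right _ _ (tendsto_atTop_add_const_left _ _
      (tendsto_natCast_atTop_atTop.const_mul_atTop two_pos))
  have hq : Tendsto q atTop (𝓝 (|r| ^ 2 * ((1 + 0) * ((1 + 0) * (1 + 0))))) := by
    refine Tendsto.const_mul _ (Tendsto.mul ?_ (Tendsto.mul ?_ ?_)) <;>
      refine Tendsto.const_add _ (tendsto_const_nhds.div_atTop ?_)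
    · exact tendsto_atTop_add_const_right _ _ tendsto_natCast_atTop_atTop
    · exact hinf 1
    · exact hinf 2
  have hr2 : |r| ^ 2 < 1 := pow_lt_one₀ (abs_nonneg r) hr two_ne_zero
  obtain ⟨l, hl, hl1⟩ := exists_between hr2
  refine summable_of_ratio_norm_eventually_le hl1 ?_
  filter_upwards [hq.eventually_lt_const (by simpa using hl)] with n hn
  have hn0 : (0 : ℝ) ≤ n := n.cast_nonneg
  have g1 := Real.Gamma_pos_of_pos (s := μ + n + 1) (by linarith)
  have g2 := Real.Gamma_pos_of_pos (s := (n : ℝ) + 1) (by linarith)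
  have g3 := Real.Gamma_pos_of_pos (s := μ + 1) (by linarith)
  have g4 := Real.Gamma_pos_of_pos (s := 2 * μ + 2 * n + 1 + σ) (by linarith)
  have g5 := Real.Gamma_pos_of_pos (s := 2 * μ + 2 * n + 1) (by linarith)
  have e1 : Real.Gamma (μ + (n + 1 : ℕ) + 1) = (μ + n + 1) * Real.Gamma (μ + n + 1) := by
    rw [← Real.Gamma_add_one (by linarith)]; push_cast; ring_nf
  have e2 : Real.Gamma ((n + 1 : ℕ) + 1) = (n + 1) * Real.Gamma (n + 1) := by
    rw [← Real.Gamma_add_one (by linarith)]; push_cast; ring_nf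
  have e3 (c : ℝ) (hc : 0 ≤ c) : Real.Gamma (2 * μ + 2 * (n + 1 : ℕ) + 1 + c) =
      (2 * μ + 2 * n + 2 + c) * ((2 * μ + 2 * n + 1 + c) *
        Real.Gamma (2 * μ + 2 * n + 1 + c)) := by
    rw [← Real.Gamma_add_one (by linarith),
      show 2 * μ + 2 * (n : ℝ) + 1 + c + 1 = 2 * μ + 2 * n + 2 + c by ring,
      ← Real.Gamma_add_one (by linarith)]
    push_cast; ring_nf
  have e4 := e3 0 le_rfl
  simp only [add_zero] at e4
  rw [e1, e2, e3 σ hσ, e4, Real.norm_of_nonneg (by positivity), Real.norm_of_nonneg (by positivity)]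
  refine le_trans (le_of_eq ?_) (mul_le_mul_of_nonneg_right hn.le (by positivity))
  simp only [q]
  have : (0 : ℝ) < 2 * μ + 2 * n + 1 := by linarith
  have : (0 : ℝ) < 2 * μ + 2 * n + 2 := by linarith
  field_simp
  ring

/-! ### Gaussian integrals and the Mellin transform of the Bessel kernel. -/

theorem hasMellin_exp_neg {s : ℂ} (hs : 0 < s.re) :
    HasMellin (fun t : ℝ => ((Real.exp (-t) : ℝ) : ℂ)) s (Complex.Gamma s) := by
  refine ⟨?_, ?_⟩
  · refine (Complex.GammaIntegral_convergent hs).congr_fun (fun x _ => ?_) measurableSet_Ioi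
    rw [smul_eq_mul, mul_comm]
  · rw [Complex.Gamma_eq_integral hs, Complex.GammaIntegral_eq_mellin]

theorem hasMellin_exp_neg_sq {s : ℂ} (hs : 0 < s.re) :
    HasMellin (fun t : ℝ => ((Real.exp (-t ^ 2) : ℝ) : ℂ)) s (Complex.Gamma (s / 2) / 2) := by
  have h := hasMellin_exp_neg (s := s / 2) (by simpa using hs)
  have e : (fun t : ℝ => ((Real.exp (-t ^ 2) : ℝ) : ℂ)) =
      fun t : ℝ => (fun t : ℝ => ((Real.exp (-t) : ℝ) : ℂ)) (t ^ (2 : ℝ)) := by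
    ext t; simp
  rw [e]
  have h1 : MellinConvergent (fun t : ℝ => ((Real.exp (-t) : ℝ) : ℂ)) (s / (2 : ℝ)) := by
    rw [Complex.ofReal_ofNat]
    exact h.1
  refine ⟨(MellinConvergent.comp_rpow two_ne_zero).2 h1, ?_⟩
  have h2 := mellin_comp_rpow (fun t : ℝ => ((Real.exp (-t) : ℝ) : ℂ)) s 2
  rw [Complex.ofReal_ofNat, h.2] at h2
  refine h2.trans ?_
  simp
  ring

/-- The Gaussian moments `Γ(n+μ+1/2)/2` cancel the Gamma factors in the series of the kernel,
leaving an exponential series. -/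
theorem integral_rpow_mul_exp_neg_sq_mul_besselKernel {μ : ℝ} (hμ : 0 < μ) (r : ℝ) :
    ∫ x in Ioi (0 : ℝ), besselKernel μ (r * x) * (x ^ (2 * μ) * Real.exp (-x ^ 2)) =
      Real.exp (-r ^ 2 / 4) / 2 := by
  set D : ℕ → ℝ := fun n => (n.factorial : ℝ) * Real.Gamma (n + (μ - 1 / 2) + 1)
  have hG (n : ℕ) : 0 < Real.Gamma (n + (μ - 1 / 2) + 1) :=
    Real.Gamma_pos_of_pos (by have : (0 : ℝ) ≤ n := n.cast_nonneg; linarith)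
  have hf (n : ℕ) : (0 : ℝ) < n.factorial := by exact_mod_cast n.factorial_pos
  set F : ℕ → ℝ → ℝ := fun n x =>
    (-(r ^ 2 / 4)) ^ n / D n * (x ^ (2 * μ + 2 * n) * Real.exp (-x ^ (2 : ℝ)))
  have hI (n : ℕ) : ∫ x in Ioi (0 : ℝ), x ^ (2 * μ + 2 * n) * Real.exp (-x ^ (2 : ℝ)) =
      Real.Gamma (n + (μ - 1 / 2) + 1) / 2 := by
    have hn : (0 : ℝ) ≤ n := n.cast_nonneg
    rw [integral_rpow_mul_exp_neg_rpow two_pos (by linarith)]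
    ring_nf
  have hint (n : ℕ) : IntegrableOn
      (fun x : ℝ => x ^ (2 * μ + 2 * n) * Real.exp (-x ^ (2 : ℝ))) (Ioi 0) :=
    integrableOn_rpow_mul_exp_neg_rpow
      (by have : (0 : ℝ) ≤ n := n.cast_nonneg; linarith) two_pos
  have hnorm (n : ℕ) : ∫ x in Ioi (0 : ℝ), ‖F n x‖ = (r ^ 2 / 4) ^ n / n.factorial / 2 := by
    have : ∀ x ∈ Ioi (0 : ℝ), ‖F n x‖ =
        (r ^ 2 / 4) ^ n / D n * (x ^ (2 * μ + 2 * n) * Real.exp (-x ^ (2 : ℝ))) := by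
      intro x hx
      have hx : 0 < x := hx
      have hD : 0 < D n := mul_pos (hf n) (hG n)
      simp only [F]
      rw [norm_mul, norm_div, norm_pow, norm_neg, Real.norm_of_nonneg hD.le,
        Real.norm_of_nonneg (by positivity : 0 ≤ r ^ 2 / 4), Real.norm_of_nonneg (by positivity)]
    rw [setIntegral_congr_fun measurableSet_Ioi this, integral_const_mul, hI]
    have := (hG n).ne'
    have := (hf n).ne'
    simp only [D]
    generalize Real.Gamma (n + (μ - 1 / 2) + 1) = G at *
    field_simp
  have key := hasSum_integral_of_summable_integral_norm (μ := volume.restrict (Ioi (0 : ℝ)))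
    (F := F) (fun n => (hint n).const_mul _) (by
      simp only [hnorm]
      exact (Real.summable_pow_div_factorial _).div_const 2)
  have h1 : HasSum (fun n => ∫ x in Ioi (0 : ℝ), F n x) (Real.exp (-r ^ 2 / 4) / 2) := by
    have := (NormedSpace.expSeries_div_hasSum_exp (𝔸 := ℝ) (-r ^ 2 / 4)).div_const 2
    rw [← Real.exp_eq_exp_ℝ] at this
    convert! this using 2 with n
    simp only [F]
    rw [integral_const_mul, hI]
    have := (hG n).ne'
    have := (hf n).ne'
    simp only [D]
    rw [neg_div]
    generalize Real.Gamma (n + (μ - 1 / 2) + 1) = G at *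
    field_simp
  rw [h1.unique key]
  refine setIntegral_congr_fun measurableSet_Ioi fun x hx => ?_
  have hx : 0 < x := hx
  simp only [besselKernel, besselClifford, ← tsum_mul_right]
  refine tsum_congr fun n => ?_
  have : x ^ (2 * μ + 2 * n) = x ^ (2 * μ) * (x ^ 2) ^ n := by
    rw [Real.rpow_add hx, ← pow_mul, ← Real.rpow_natCast]
    push_cast
    rfl
  simp only [F, D, this, Real.rpow_two]
  rw [show -((r * x) ^ 2 / 4) = -(r ^ 2 / 4) * x ^ 2 by ring, mul_pow (-(r ^ 2 / 4))]
  ring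

theorem ofReal_rpow_eq_cpow {x : ℝ} (hx : 0 < x) (a : ℝ) : ((x ^ a : ℝ) : ℂ) = (x : ℂ) ^ (a : ℂ) :=
  Complex.ofReal_cpow hx.le a

/-- Convolving the kernel with `x^(2μ) e^(-x²)` gives a Gaussian in `r`. Both Gaussian transforms
are known and the Gamma factor multiplying the unknown one is nonzero, so it can be solved for. -/
theorem mellin_besselKernel {μ : ℝ} (hμ : 0 < μ) {s : ℂ} (hs : 0 < s.re) (hs' : s.re < μ) :
    mellin (fun y => (besselKernel μ y : ℂ)) s =
      2 ^ (s - 1) * Complex.Gamma (s / 2) / Complex.Gamma (μ + 1 / 2 - s / 2) := by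
  set h : ℝ → ℂ := fun x => ((x ^ (2 * μ) * Real.exp (-x ^ 2) : ℝ) : ℂ)
  have hh : EqOn (fun x : ℝ => (x : ℂ) ^ (2 * μ + 1 - s - 1) • ((Real.exp (-x ^ 2) : ℝ) : ℂ))
      (fun x : ℝ => (x : ℂ) ^ (-s) * h x) (Ioi 0) := fun x hx => by
    have hx : 0 < x := hx
    have hx' : (x : ℂ) ≠ 0 := by exact_mod_cast hx.ne'
    simp only [h, smul_eq_mul]
    rw [show 2 * (μ : ℂ) + 1 - s - 1 = -s + 2 * μ by ring, Complex.cpow_add _ _ hx',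
      Complex.ofReal_mul, ofReal_rpow_eq_cpow hx]
    push_cast
    ring
  have hm := hasMellin_exp_neg_sq (s := 2 * μ + 1 - s) (by simp; linarith)
  have hconv := hasMellin_integral_comp_mul (k := fun y => (besselKernel μ y : ℂ)) (h := h)
    (Complex.continuous_ofReal.comp (continuous_besselKernel hμ))
    (mellinConvergent_besselKernel hμ hs hs')
    (Complex.continuous_ofReal.comp_continuousOn (ContinuousOn.mul
      (fun x hx => (Real.continuousAt_rpow_const x _
        (Or.inl (ne_of_gt hx))).continuousWithinAt) (by fun_prop)))
    (hm.1.congr_fun hh measurableSet_Ioi)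
  have e1 : ∫ x in Ioi (0 : ℝ), (x : ℂ) ^ (-s) * h x =
      Complex.Gamma (μ + 1 / 2 - s / 2) / 2 := by
    rw [← setIntegral_congr_fun measurableSet_Ioi hh]
    refine hm.2.trans ?_
    ring_nf
  have e2 (r : ℝ) : ∫ x in Ioi (0 : ℝ), (besselKernel μ (r * x) : ℂ) * h x =
      (1 / 2 : ℂ) • ((Real.exp (-(1 / 2 * r) ^ 2) : ℝ) : ℂ) := by
    have := congrArg Complex.ofReal (integral_rpow_mul_exp_neg_sq_mul_besselKernel hμ r)
    rw [← integral_complex_ofReal] at this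
    simp only [h, ← Complex.ofReal_mul]
    rw [this, show -r ^ 2 / 4 = -(1 / 2 * r) ^ 2 by ring]
    push_cast
    rw [smul_eq_mul]
    ring
  have h2 := hconv.2
  rw [e1] at h2
  simp only [e2] at h2
  rw [mellin_const_smul,
    mellin_comp_mul_left (fun t : ℝ => ((Real.exp (-t ^ 2) : ℝ) : ℂ)) s (by norm_num),
    (hasMellin_exp_neg_sq hs).2] at h2
  have hne : Complex.Gamma (μ + 1 / 2 - s / 2) ≠ 0 :=
    Complex.Gamma_ne_zero_of_re_pos (by simp; linarith)
  have h3 : (((1 / 2 : ℝ) : ℂ)) ^ (-s) = 2 ^ s := by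
    push_cast
    rw [one_div, Complex.inv_cpow _ _ (by
        rw [← Complex.ofReal_ofNat, Complex.arg_ofReal_of_nonneg two_pos.le]; exact Real.pi_pos.ne),
      Complex.cpow_neg, inv_inv]
  rw [h3] at h2
  rw [eq_div_iff hne, Complex.cpow_sub _ _ two_ne_zero, Complex.cpow_one]
  simp only [smul_eq_mul] at h2
  linear_combination -2 * h2

/-! ### The extended zeta function and its transform in `p`. -/

theorem mellinConvergent_and_integral_norm_le {p : ℂ} (hp : 0 ≤ p.re) {α : ℝ} (hα : 1 < α) :
    MellinConvergent (boseWeight p) α ∧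
      ∫ x in Ioi (0 : ℝ), ‖(x : ℂ) ^ ((α : ℂ) - 1) • boseWeight p x‖ ≤
        Real.Gamma α * ‖riemannZeta α‖ := by
  have h0 := hasMellin_boseWeight_zero (a := α) (by simpa using hα)
  have hle (x : ℝ) (hx : 0 < x) : ‖(x : ℂ) ^ ((α : ℂ) - 1) • boseWeight p x‖ ≤
      ‖(x : ℂ) ^ ((α : ℂ) - 1) • boseWeight 0 x‖ := by
    rw [norm_smul, norm_smul, norm_boseWeight p hx, norm_boseWeight 0 hx]
    have h : 0 < Real.exp x - 1 := by linarith [Real.add_one_le_exp x]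
    exact mul_le_mul_of_nonneg_left (div_le_div_of_nonneg_right (Real.exp_le_exp.2
      (div_le_div_of_nonneg_right (by simpa using hp) hx.le)) h.le) (norm_nonneg _)
  have hconv : MellinConvergent (boseWeight p) α := by
    refine Integrable.mono h0.1 ?_ ((ae_restrict_iff' measurableSet_Ioi).2 (ae_of_all _ hle))
    refine ContinuousOn.aestronglyMeasurable (fun x hx => ?_) measurableSet_Ioi
    exact ((Complex.continuousAt_ofReal_cpow_const x _ (Or.inr (ne_of_gt hx))).smul
      (hasDerivAt_boseWeight p hx).continuousAt).continuousWithinAt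
  refine ⟨hconv, (setIntegral_mono_on hconv.norm h0.1.norm measurableSet_Ioi hle).trans ?_⟩
  have hcast : ((∫ x in Ioi (0 : ℝ), ‖(x : ℂ) ^ ((α : ℂ) - 1) • boseWeight 0 x‖ : ℝ) : ℂ) =
      mellin (boseWeight 0) α := by
    rw [← integral_complex_ofReal]
    refine setIntegral_congr_fun measurableSet_Ioi fun x hx => ?_
    have hx : 0 < x := hx
    rw [norm_smul, norm_boseWeight 0 hx, Complex.norm_cpow_eq_rpow_re_of_pos hx,
      smul_eq_mul, boseWeight, Complex.ofReal_mul, ofReal_rpow_eq_cpow hx]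
    simp
  have hnn : 0 ≤ ∫ x in Ioi (0 : ℝ), ‖(x : ℂ) ^ ((α : ℂ) - 1) • boseWeight 0 x‖ :=
    integral_nonneg fun x => norm_nonneg _
  rw [← Complex.norm_of_nonneg hnn, hcast, h0.2, norm_mul, Complex.Gamma_ofReal,
    Complex.norm_of_nonneg (Real.Gamma_pos_of_pos (by linarith)).le]

theorem norm_zetaExt_le {p : ℂ} (hp : 0 ≤ p.re) {α : ℝ} (hα : 1 < α) :
    ‖zetaExt p α‖ ≤ ‖riemannZeta α‖ := by
  have hG := Real.Gamma_pos_of_pos (s := α) (by linarith)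
  rw [zetaExt_eq_mellin, norm_mul, norm_div, norm_one, Complex.Gamma_ofReal,
    Complex.norm_of_nonneg hG.le, one_div, inv_mul_le_iff₀ hG]
  exact (norm_integral_le_integral_norm _).trans (mellinConvergent_and_integral_norm_le hp hα).2

/-- Positivity of the integrand; it turns the integral over `p` of the norms into the Mellin
transform at `Re s`. -/
theorem ofReal_norm_zetaExt {p α : ℝ} (hα : 0 < α) :
    ((‖zetaExt p α‖ : ℝ) : ℂ) = zetaExt p α := by
  have h : zetaExt p α = ((1 / Real.Gamma α * ∫ x in Ioi (0 : ℝ),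
      x ^ (α - 1) * (Real.exp (-p / x) / (Real.exp x - 1)) : ℝ) : ℂ) := by
    rw [zetaExt_eq_mellin, mellin, Complex.ofReal_mul, ← integral_complex_ofReal,
      Complex.ofReal_div, Complex.ofReal_one, Complex.Gamma_ofReal]
    congr 1
    refine setIntegral_congr_fun measurableSet_Ioi fun x hx => ?_
    simp only [Complex.ofReal_mul, ofReal_rpow_eq_cpow hx, boseWeight, smul_eq_mul]
    push_cast
    rfl
  rw [h, Complex.norm_of_nonneg]
  have hG := Real.Gamma_pos_of_pos hα
  refine mul_nonneg (by positivity) (setIntegral_nonneg measurableSet_Ioi fun x hx => ?_)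
  have hx : 0 < x := hx
  have h : 0 < Real.exp x - 1 := by linarith [Real.add_one_le_exp x]
  positivity

theorem hasMellin_zetaExt {α : ℝ} (hα : 1 < α) {s : ℂ} (hs : 0 < s.re) :
    HasMellin (fun p : ℝ => zetaExt p α) s
      (Complex.Gamma s * Complex.Gamma (α + s) * riemannZeta (α + s) / Complex.Gamma α) := by
  have hz := hasMellin_boseWeight_zero (a := α + s) (by simp; linarith)
  have hE : EqOn (fun u : ℝ => (u : ℂ) ^ (-(α + s) - 1) • boseWeight 0 u⁻¹)
      (fun u : ℝ => (u : ℂ) ^ (-s) * ((u : ℂ) ^ (-(α : ℂ) - 1) * boseWeight 0 u⁻¹)) (Ioi 0) := by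
    intro u hu
    have hu' : (u : ℂ) ≠ 0 := by exact_mod_cast (ne_of_gt hu)
    simp only [smul_eq_mul]
    rw [show -(α + s) - 1 = -s + (-(α : ℂ) - 1) by ring, Complex.cpow_add _ _ hu', mul_assoc]
  have hinv : MellinConvergent (fun u : ℝ => boseWeight 0 u⁻¹) (-(α + s)) := by
    have := (MellinConvergent.comp_rpow (f := boseWeight 0) (s := -(α + s))
      (a := -1) (by norm_num)).2 (by simpa [div_neg] using hz.1)
    simpa only [Real.rpow_neg_one] using this
  have key := hasMellin_integral_comp_mul (k := fun t : ℝ => ((Real.exp (-t) : ℝ) : ℂ)) (s := s)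
    (h := fun u : ℝ => (u : ℂ) ^ (-(α : ℂ) - 1) * boseWeight 0 u⁻¹) (by fun_prop)
    (hasMellin_exp_neg hs).1 (fun u hu => ContinuousAt.continuousWithinAt (by
      have hu' : u ≠ 0 := ne_of_gt hu
      refine (Complex.continuousAt_ofReal_cpow_const u _ (Or.inr hu')).mul ?_
      exact ContinuousAt.comp (f := fun u : ℝ => u⁻¹)
        (hasDerivAt_boseWeight 0 (inv_pos.2 hu)).continuousAt (continuousAt_inv₀ hu')))
    (hinv.congr_fun hE measurableSet_Ioi)
  have hval : ∫ u in Ioi (0 : ℝ), (u : ℂ) ^ (-s) *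
      ((u : ℂ) ^ (-(α : ℂ) - 1) * boseWeight 0 u⁻¹) =
      Complex.Gamma (α + s) * riemannZeta (α + s) := by
    rw [← setIntegral_congr_fun measurableSet_Ioi hE, ← hz.2]
    have := mellin_comp_inv (boseWeight 0) (-(α + s))
    rw [neg_neg] at this
    exact this
  rw [hval, (hasMellin_exp_neg hs).2] at key
  have hfun (p : ℝ) : ∫ u in Ioi (0 : ℝ), ((Real.exp (-(p * u)) : ℝ) : ℂ) *
      ((u : ℂ) ^ (-(α : ℂ) - 1) * boseWeight 0 u⁻¹) = Complex.Gamma α * zetaExt p α := by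
    have hG : Complex.Gamma α ≠ 0 := Complex.Gamma_ne_zero_of_re_pos (by simp; linarith)
    have h1 := mellin_comp_inv (boseWeight p) (-(α : ℂ))
    rw [neg_neg] at h1
    rw [zetaExt_eq_mellin, ← h1, mellin]
    field_simp
    refine setIntegral_congr_fun measurableSet_Ioi fun u hu => ?_
    simp only [boseWeight, smul_eq_mul]
    push_cast
    simp
    ring
  simp only [hfun] at key
  have hG : Complex.Gamma α ≠ 0 := Complex.Gamma_ne_zero_of_re_pos (by simp; linarith)
  have := hasMellin_const_smul key.1 (Complex.Gamma α)⁻¹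
  rw [key.2] at this
  convert! this using 1
  · ext p
    rw [smul_eq_mul, inv_mul_cancel_left₀ hG]
  · rw [smul_eq_mul]
    ring

/-! ### The Mathieu series: transform in `p`. -/

theorem binom_add_natCast {μ : ℝ} (n : ℕ) :
    binom (μ + n) n =
      ((Real.Gamma (μ + n + 1) / (Real.Gamma (n + 1) * Real.Gamma (μ + 1)) : ℝ) : ℂ) := by
  rw [binom, add_sub_cancel_right]
  push_cast [← Complex.Gamma_ofReal]
  rfl

theorem norm_mathieu_coeff {μ : ℝ} (hμ : 0 < μ) (r : ℝ) (n : ℕ) :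
    ‖(r : ℂ) ^ (2 * n) * (-1) ^ n * binom (μ + n) n‖ =
      |r| ^ (2 * n) * (Real.Gamma (μ + n + 1) / (Real.Gamma (n + 1) * Real.Gamma (μ + 1))) := by
  have hn0 : (0 : ℝ) ≤ n := n.cast_nonneg
  have g1 := Real.Gamma_pos_of_pos (s := μ + n + 1) (by linarith)
  have g2 := Real.Gamma_pos_of_pos (s := (n : ℝ) + 1) (by linarith)
  have g3 := Real.Gamma_pos_of_pos (s := μ + 1) (by linarith)
  rw [binom_add_natCast, norm_mul, norm_mul, Complex.norm_of_nonneg (by positivity)]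
  simp

theorem summable_and_hasMellin_mathieuExt {μ r : ℝ} (hμ : 0 < μ) (hr : |r| < 1) {s : ℂ}
    (hs : 0 < s.re) :
    Summable (fun n : ℕ => (-(r : ℂ) ^ 2) ^ n * binom (μ + n) n *
      binom (2 * μ + 2 * n + s) (2 * μ + 2 * n) * riemannZeta (2 * μ + 2 * n + s + 1)) ∧
    HasMellin (fun p : ℝ => mathieuExt μ (p : ℂ) r) s
      (2 * s * Complex.Gamma s ^ 2 *
        ∑' n : ℕ, (-(r : ℂ) ^ 2) ^ n * binom (μ + n) n *
          binom (2 * μ + 2 * n + s) (2 * μ + 2 * n) *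
          riemannZeta (2 * μ + 2 * n + s + 1)) := by
  set c : ℕ → ℂ := fun n => (r : ℂ) ^ (2 * n) * (-1) ^ n * binom (μ + n) n
  set α : ℕ → ℝ := fun n => 2 * μ + 2 * n + 1
  have hα (n : ℕ) : 1 < α n := by
    have : (0 : ℝ) ≤ n := n.cast_nonneg
    simp only [α]; linarith
  have hα' (n : ℕ) : 2 * μ + 1 ≤ α n := by
    have : (0 : ℝ) ≤ n := n.cast_nonneg
    simp only [α]; linarith
  obtain ⟨C, hC0, hC⟩ := exists_norm_riemannZeta_bound (a := 2 * μ + 1) (by linarith)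
  set F : ℕ → ℝ → ℂ := fun n p => c n * ((p : ℂ) ^ (s - 1) • zetaExt p (α n))
  have hF (n : ℕ) : IntegrableOn (F n) (Ioi 0) :=
    (hasMellin_zetaExt (hα n) hs).1.const_mul (c n)
  have hFint (n : ℕ) : ∫ p in Ioi (0 : ℝ), F n p = c n * (Complex.Gamma s *
      Complex.Gamma (α n + s) * riemannZeta (α n + s) / Complex.Gamma (α n)) := by
    rw [integral_const_mul]
    congr 1
    exact (hasMellin_zetaExt (hα n) hs).2
  have hnorm (n : ℕ) : ∫ p in Ioi (0 : ℝ), ‖F n p‖ ≤ Real.Gamma s.re * C *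
      (|r| ^ (2 * n) * (Real.Gamma (μ + n + 1) / (Real.Gamma (n + 1) * Real.Gamma (μ + 1))) *
      (Real.Gamma (2 * μ + 2 * n + 1 + s.re) / Real.Gamma (2 * μ + 2 * n + 1))) := by
    have h1 : ((∫ p in Ioi (0 : ℝ), ‖(p : ℂ) ^ (s - 1) • zetaExt p (α n)‖ : ℝ) : ℂ) =
        mellin (fun p : ℝ => zetaExt p (α n)) s.re := by
      rw [← integral_complex_ofReal]
      refine setIntegral_congr_fun measurableSet_Ioi fun p hp => ?_
      have hp : 0 < p := hp
      simp only
      rw [norm_smul, Complex.ofReal_mul, ofReal_norm_zetaExt (one_pos.trans (hα n)),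
        Complex.norm_cpow_eq_rpow_re_of_pos hp, ofReal_rpow_eq_cpow hp, smul_eq_mul]
      simp
    rw [(hasMellin_zetaExt (hα n) (by simpa using hs)).2] at h1
    have h2 : 0 ≤ ∫ p in Ioi (0 : ℝ), ‖(p : ℂ) ^ (s - 1) • zetaExt p (α n)‖ :=
      integral_nonneg fun _ => norm_nonneg _
    have g1 := Real.Gamma_pos_of_pos hs
    have g2 := Real.Gamma_pos_of_pos (s := α n) (by linarith [hα n])
    have g3 := Real.Gamma_pos_of_pos (s := α n + s.re) (by linarith [hα n])
    have hz : ‖riemannZeta (α n + s.re)‖ ≤ C := hC _ (by simp; linarith [hα' n])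
    simp only [F, norm_mul]
    rw [integral_const_mul, norm_mathieu_coeff hμ, ← Complex.norm_of_nonneg h2, h1,
      norm_div, norm_mul, norm_mul, ← Complex.ofReal_add, Complex.Gamma_ofReal,
      Complex.Gamma_ofReal, Complex.Gamma_ofReal, Complex.norm_of_nonneg g1.le,
      Complex.norm_of_nonneg g2.le, Complex.norm_of_nonneg g3.le, Complex.ofReal_add]
    have g4 := (norm_nonneg _).trans_eq (norm_mathieu_coeff hμ r n)
    calc _ ≤ |r| ^ (2 * n) *
          (Real.Gamma (μ + n + 1) / (Real.Gamma (n + 1) * Real.Gamma (μ + 1))) *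
          (Real.Gamma s.re * Real.Gamma (α n + s.re) * C / Real.Gamma (α n)) := by
          refine mul_le_mul_of_nonneg_left ?_ g4
          gcongr
      _ = _ := by simp only [α]; ring
  have hsum : Summable fun n => ∫ p in Ioi (0 : ℝ), ‖F n p‖ :=
    Summable.of_nonneg_of_le (fun n => integral_nonneg fun _ => norm_nonneg _) hnorm
      ((summable_mathieu_majorant hμ hs.le hr).mul_left _)
  have hpt (p : ℝ) (hp : 0 < p) : Summable fun n => c n * zetaExt p (α n) := by
    refine Summable.of_norm_bounded ((summable_mathieu_majorant hμ le_rfl hr).mul_left C)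
      fun n => ?_
    have g2 := Real.Gamma_pos_of_pos (s := 2 * μ + 2 * (n : ℝ) + 1) (by linarith [hα n])
    rw [add_zero, div_self g2.ne', mul_one, norm_mul, norm_mathieu_coeff hμ, mul_comm]
    refine mul_le_mul_of_nonneg_right ?_ ((norm_nonneg _).trans_eq (norm_mathieu_coeff hμ r n))
    exact (norm_zetaExt_le (by simpa using hp.le) (hα n)).trans (hC _ (by simpa using hα' n))
  have hfun (p : ℝ) : (p : ℂ) ^ (s - 1) • mathieuExt μ p r = 2 * ∑' n, F n p := by
    rw [mathieuExt, if_pos hr, mathieuPowerSeries, smul_eq_mul, mul_left_comm, ← tsum_mul_left]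
    congr 1
    refine tsum_congr fun n => ?_
    simp only [F, c, α, smul_eq_mul]
    push_cast
    ring
  -- The second binomial contributes `1/Γ(s+1) = 1/(s Γ(s))`, which reduces the prefactor `2 s
  -- Γ(s)²` to `2 Γ(s)`.
  have hterm (n : ℕ) : 2 * s * Complex.Gamma s ^ 2 *
      ((-(r : ℂ) ^ 2) ^ n * binom (μ + n) n *
      binom (2 * μ + 2 * n + s) (2 * μ + 2 * n) * riemannZeta (2 * μ + 2 * n + s + 1)) =
      2 * ∫ p in Ioi (0 : ℝ), F n p := by
    have hs0 : s ≠ 0 := by rintro rfl; simp at hs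
    have hG := Complex.Gamma_ne_zero_of_re_pos hs
    rw [hFint, binom.eq_def (2 * μ + 2 * n + s), add_sub_cancel_left, Complex.Gamma_add_one _ hs0]
    simp only [c, α]
    push_cast
    rw [show 2 * (μ : ℂ) + 2 * n + 1 + s = 2 * μ + 2 * n + s + 1 by ring, neg_pow, ← pow_mul]
    field_simp
  have hne : 2 * s * Complex.Gamma s ^ 2 ≠ 0 := by
    have hs0 : s ≠ 0 := by rintro rfl; simp at hs
    have hG := Complex.Gamma_ne_zero_of_re_pos hs
    exact mul_ne_zero (mul_ne_zero two_ne_zero hs0) (pow_ne_zero 2 hG)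
  have key := hasSum_integral_of_summable_integral_norm (μ := volume.restrict (Ioi (0 : ℝ))) hF hsum
  refine ⟨?_, ?_, ?_⟩
  · rw [← summable_mul_left_iff hne]
    simp only [hterm]
    exact key.summable.mul_left 2
  · simp only [MellinConvergent, hfun]
    refine (integrable_tsum_of_summable_integral_norm hF hsum ?_).const_mul 2
    refine (ae_restrict_iff' measurableSet_Ioi).2 (ae_of_all _ fun p hp => ?_)
    refine ((hpt p hp).mul_left ((p : ℂ) ^ (s - 1))).congr fun n => ?_
    simp only [F, smul_eq_mul]
    ring
  · rw [← tsum_mul_left]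
    simp only [hterm, mellin, hfun]
    rw [tsum_mul_left, integral_const_mul, key.tsum_eq]

/-! ### Integration by parts against the weight. -/

/-- The derivative of `boseWeight p`. -/
noncomputable def boseWeightDeriv (p : ℂ) (x : ℝ) : ℂ :=
  boseWeight p x * (p / (x : ℂ) ^ 2 - 1 - 1 / (Complex.exp (x : ℂ) - 1))

theorem norm_boseWeightDeriv_le (p : ℂ) {x : ℝ} (hx : 0 < x) :
    ‖boseWeightDeriv p x‖ ≤ ‖boseWeight p x‖ * (‖p‖ * x ^ (-2 : ℝ) + 1 + x ^ (-1 : ℝ)) := by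
  have he : x ≤ Real.exp x - 1 := by linarith [Real.add_one_le_exp x]
  rw [boseWeightDeriv, norm_mul]
  refine mul_le_mul_of_nonneg_left ?_ (norm_nonneg _)
  have h1 : ‖p / (x : ℂ) ^ 2‖ = ‖p‖ * x ^ (-2 : ℝ) := by
    rw [norm_div, norm_pow, Complex.norm_of_nonneg hx.le, Real.rpow_neg hx.le, Real.rpow_two,
      div_eq_mul_inv]
  have h2 : ‖1 / (Complex.exp (x : ℂ) - 1)‖ ≤ x ^ (-1 : ℝ) := by
    rw [← Complex.ofReal_exp, ← Complex.ofReal_one, ← Complex.ofReal_sub, norm_div,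
      Complex.norm_of_nonneg (hx.le.trans he), Complex.norm_of_nonneg zero_le_one, one_div,
      Real.rpow_neg_one]
    exact inv_anti₀ hx he
  refine (norm_sub_le _ _).trans (add_le_add ((norm_sub_le _ _).trans ?_) h2)
  rw [h1, norm_one]

theorem continuousOn_boseWeightDeriv (p : ℂ) : ContinuousOn (boseWeightDeriv p) (Ioi 0) := by
  refine (continuousOn_boseWeight p).mul (ContinuousOn.sub (ContinuousOn.sub ?_ (by fun_prop)) ?_)
  · refine ContinuousOn.div (by fun_prop) (by fun_prop) fun x hx => pow_ne_zero 2 ?_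
    exact_mod_cast (ne_of_gt hx)
  · exact ContinuousOn.div (by fun_prop) (by fun_prop) fun x hx => exp_sub_one_ne_zero hx

theorem integrableOn_rpow_mul_norm_boseWeight {p : ℂ} (hp : 0 < p.re) (b : ℝ) :
    IntegrableOn (fun x => x ^ b * ‖boseWeight p x‖) (Ioi 0) := by
  refine IntegrableOn.congr_fun (f := fun x : ℝ => ‖(x : ℂ) ^ ((b + 1 : ℂ) - 1) • boseWeight p x‖)
    (mellinConvergent_boseWeight hp (b + 1)).norm (fun x hx => ?_) measurableSet_Ioi
  simp [Complex.norm_cpow_eq_rpow_re_of_pos hx]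

theorem integrableOn_mul_boseWeight {p : ℂ} (hp : 0 < p.re) {f : ℝ → ℂ}
    (hf : ContinuousOn f (Ioi 0)) {C b : ℝ} (hC : ∀ x, 0 < x → ‖f x‖ ≤ C * x ^ b) :
    IntegrableOn (f * boseWeight p) (Ioi 0) := by
  refine Integrable.mono' ((integrableOn_rpow_mul_norm_boseWeight hp b).const_mul C)
    ((hf.mul (continuousOn_boseWeight p)).aestronglyMeasurable measurableSet_Ioi) ?_
  refine (ae_restrict_iff' measurableSet_Ioi).2 (ae_of_all _ fun x hx => ?_)
  rw [Pi.mul_apply, norm_mul, ← mul_assoc]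
  exact mul_le_mul_of_nonneg_right (hC x hx) (norm_nonneg _)

theorem integrableOn_mul_boseWeightDeriv {p : ℂ} (hp : 0 < p.re) {f : ℝ → ℂ}
    (hf : ContinuousOn f (Ioi 0)) {C b : ℝ} (hC : ∀ x, 0 < x → ‖f x‖ ≤ C * x ^ b) :
    IntegrableOn (f * boseWeightDeriv p) (Ioi 0) := by
  have hI := integrableOn_rpow_mul_norm_boseWeight hp
  refine Integrable.mono' ((((hI (b - 2)).const_mul ‖p‖).add (hI b)).add (hI (b - 1)) |>.const_mul C)
    ((hf.mul (continuousOn_boseWeightDeriv p)).aestronglyMeasurable measurableSet_Ioi) ?_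
  refine (ae_restrict_iff' measurableSet_Ioi).2 (ae_of_all _ fun x hx => ?_)
  have hx : 0 < x := hx
  rw [Pi.mul_apply, norm_mul]
  refine (mul_le_mul (hC x hx) (norm_boseWeightDeriv_le p hx) (norm_nonneg _)
    ((norm_nonneg _).trans (hC x hx))).trans (le_of_eq ?_)
  simp only [Pi.add_apply, sub_eq_add_neg, Real.rpow_add hx]
  ring

/-- The weight decays faster than any power at `0` and at infinity, so power bounds on `u` and `u'`
make every integral converge and both boundary terms vanish. -/
theorem integral_mul_boseWeightDeriv {p : ℂ} (hp : 0 < p.re) {u u' : ℝ → ℂ}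
    (hu : ∀ x, 0 < x → HasDerivAt u (u' x) x) (hu' : ContinuousOn u' (Ioi 0)) {C b C' b' : ℝ}
    (hC : ∀ x, 0 < x → ‖u x‖ ≤ C * x ^ b) (hC' : ∀ x, 0 < x → ‖u' x‖ ≤ C' * x ^ b') :
    ∫ x in Ioi (0 : ℝ), u x * boseWeightDeriv p x =
      -∫ x in Ioi (0 : ℝ), u' x * boseWeight p x := by
  have hcont : ContinuousOn u (Ioi 0) := fun x hx => (hu x hx).continuousAt.continuousWithinAt
  obtain ⟨t0, t1⟩ := tendsto_rpow_mul_norm_boseWeight hp b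
  have hle (x : ℝ) (hx : 0 < x) : ‖(u * boseWeight p) x‖ ≤ C * (x ^ b * ‖boseWeight p x‖) := by
    rw [Pi.mul_apply, norm_mul, ← mul_assoc]
    exact mul_le_mul_of_nonneg_right (hC x hx) (norm_nonneg _)
  have h := integral_Ioi_mul_deriv_eq_deriv_mul (a := 0) (a' := 0) (b' := 0) (u := u)
    (v := boseWeight p) (fun x hx => hu x hx) (fun x hx => hasDerivAt_boseWeight p hx)
    (integrableOn_mul_boseWeightDeriv hp hcont hC) (integrableOn_mul_boseWeight hp hu' hC')
    (squeeze_zero_norm' (by filter_upwards [self_mem_nhdsWithin] with x hx using hle x hx)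
      (by simpa using t0.const_mul C))
    (squeeze_zero_norm' (by filter_upwards [eventually_gt_atTop 0] with x hx using hle x hx)
      (by simpa using t1.const_mul C))
  rw [sub_zero, zero_sub] at h
  exact h

theorem integral_cpow_mul_boseWeightDeriv {p : ℂ} (hp : 0 < p.re) (a : ℂ) :
    ∫ x in Ioi (0 : ℝ), (x : ℂ) ^ a * boseWeightDeriv p x = -(a * mellin (boseWeight p) a) := by
  have hc (x : ℝ) (hx : 0 < x) (a : ℂ) : ContinuousAt (fun x : ℝ => (x : ℂ) ^ a) x :=
    Complex.continuousAt_ofReal_cpow_const x a (Or.inr hx.ne')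
  rw [integral_mul_boseWeightDeriv hp (u' := fun x : ℝ => a * (x : ℂ) ^ (a - 1)) (C := 1)
    (b := a.re) (C' := ‖a‖) (b' := a.re - 1) (fun x hx => ?_) (fun x hx => ?_) (fun x hx => ?_)
    (fun x hx => ?_)]
  · simp only [mul_assoc, integral_const_mul, mellin, smul_eq_mul]
  · simpa using ((hasDerivAt_id (x : ℂ)).cpow_const (c := a)
      (Complex.ofReal_mem_slitPlane.2 hx)).comp_ofReal
  · exact ((hc x hx (a - 1)).const_mul a).continuousWithinAt
  · rw [Complex.norm_cpow_eq_rpow_re_of_pos hx, one_mul]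
  · rw [norm_mul, Complex.norm_cpow_eq_rpow_re_of_pos hx]
    simp

/-! ### One integral representation for all `r > 0`. -/

/-- `√π 4^(1/2-μ) / Γ(μ+1)`. -/
noncomputable def mathieuConst (μ : ℝ) : ℝ :=
  √Real.pi * 4 ^ (1 / 2 - μ) / Real.Gamma (μ + 1)

theorem besselJ_eq {μ y : ℝ} (hy : 0 < y) :
    besselJ (μ - 1 / 2) y = (y / 2) ^ (μ - 1 / 2) * besselKernel μ y := by
  have hy2 : 0 < y / 2 := by positivity
  rw [besselJ, besselKernel, besselClifford, ← tsum_mul_left]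
  refine tsum_congr fun n => ?_
  rw [Real.rpow_add hy2, show (2 * (n : ℝ)) = ((2 * n : ℕ) : ℝ) by push_cast; ring,
    Real.rpow_natCast, pow_mul, show -(y ^ 2 / 4) = (-1) * (y / 2) ^ 2 by ring, mul_pow]
  ring_nf

theorem mathieuIntegral_eq {μ r : ℝ} (hr : 0 < r) (p : ℂ) :
    mathieuIntegral μ p r = mathieuConst μ *
      ∫ x in Ioi (0 : ℝ), ((x ^ (2 * μ) * besselKernel μ (r * x) : ℝ) : ℂ) * boseWeight p x := by
  rw [mathieuIntegral, ← integral_const_mul, ← integral_const_mul]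
  refine setIntegral_congr_fun measurableSet_Ioi fun x hx => ?_
  have hx : 0 < x := hx
  have h0 : x ^ (2 * μ) = x ^ (μ + 1 / 2) * x ^ (μ - 1 / 2) := by
    rw [← Real.rpow_add hx]
    ring_nf
  have h1 : √Real.pi / ((2 * r) ^ (μ - 1 / 2) * Real.Gamma (μ + 1)) *
      (x ^ (μ + 1 / 2) * besselJ (μ - 1 / 2) (r * x)) =
      mathieuConst μ * (x ^ (2 * μ) * besselKernel μ (r * x)) := by
    rw [besselJ_eq (by positivity), mathieuConst, show r * x / 2 = (2 * r) * x / 4 by ring,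
      Real.div_rpow (by positivity) (by norm_num), Real.mul_rpow (by positivity) hx.le,
      h0, show 1 / 2 - μ = -(μ - 1 / 2) by ring, Real.rpow_neg (by norm_num)]
    have : (2 * r) ^ (μ - 1 / 2) ≠ 0 := by positivity
    generalize (2 * r) ^ (μ - 1 / 2) = A at *
    generalize x ^ (μ - 1 / 2) = B
    generalize x ^ (μ + 1 / 2) = B'
    field_simp
  simp only [boseWeight]
  rw [← mul_assoc (mathieuConst μ : ℂ), ← Complex.ofReal_mul, ← h1]
  push_cast
  ring

/-- Legendre duplication at `n + μ + 1/2`; it matches the power series coefficients with those of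
the Bessel kernel. -/
theorem mathieu_coeff_eq {μ : ℝ} (hμ : 0 < μ) (n : ℕ) :
    2 * (Real.Gamma (μ + n + 1) / (Real.Gamma (n + 1) * Real.Gamma (μ + 1))) /
      Real.Gamma (2 * μ + 2 * n + 1) =
    mathieuConst μ / (4 ^ n * (n.factorial * Real.Gamma (n + (μ - 1 / 2) + 1))) := by
  have hn : (0 : ℝ) ≤ n := n.cast_nonneg
  have g1 := Real.Gamma_pos_of_pos (s := μ + n + 1) (by linarith)
  have g3 := Real.Gamma_pos_of_pos (s := μ + 1) (by linarith)
  have g4 := Real.Gamma_pos_of_pos (s := 2 * μ + 2 * n + 1) (by linarith)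
  have g5 := Real.Gamma_pos_of_pos (s := n + (μ - 1 / 2) + 1) (by linarith)
  have hf : (0 : ℝ) < n.factorial := by exact_mod_cast n.factorial_pos
  have hd := Real.Gamma_mul_Gamma_add_half (n + (μ - 1 / 2) + 1)
  rw [show (n : ℝ) + (μ - 1 / 2) + 1 + 1 / 2 = μ + n + 1 by ring,
    show 2 * ((n : ℝ) + (μ - 1 / 2) + 1) = 2 * μ + 2 * n + 1 by ring] at hd
  have h4 : (2 : ℝ) ^ (1 - (2 * μ + 2 * n + 1)) * (4 ^ n * 2) = 4 ^ (1 / 2 - μ) := by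
    rw [show (4 : ℝ) = 2 ^ (2 : ℝ) by norm_num, ← Real.rpow_natCast, ← Real.rpow_mul two_pos.le,
      ← Real.rpow_mul two_pos.le, ← Real.rpow_add_one two_ne_zero, ← Real.rpow_add two_pos]
    ring_nf
  rw [Real.Gamma_nat_eq_factorial, mathieuConst, ← h4, div_div, mul_div_assoc', div_div,
    div_eq_div_iff (by positivity) (by positivity)]
  linear_combination (2 * n.factorial * 4 ^ n * Real.Gamma (μ + 1)) * hd

theorem mathieuPowerSeries_eq {μ r : ℝ} (hμ : 0 < μ) (hr0 : 0 < r) (hr : r < 1) {p : ℂ}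
    (hp : 0 ≤ p.re) :
    mathieuPowerSeries μ p r = mathieuConst μ *
      ∫ x in Ioi (0 : ℝ), ((x ^ (2 * μ) * besselKernel μ (r * x) : ℝ) : ℂ) * boseWeight p x := by
  set c : ℕ → ℂ := fun n => (r : ℂ) ^ (2 * n) * (-1) ^ n * binom (μ + n) n
  set α : ℕ → ℝ := fun n => 2 * μ + 2 * n + 1
  have hα (n : ℕ) : 2 * μ + 1 ≤ α n := by
    have : (0 : ℝ) ≤ n := n.cast_nonneg
    simp only [α]; linarith
  have hα1 (n : ℕ) : 1 < α n := by linarith [hα n]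
  have hG (n : ℕ) : 0 < Real.Gamma (α n) := Real.Gamma_pos_of_pos (by linarith [hα n])
  obtain ⟨C, hC0, hC⟩ := exists_norm_riemannZeta_bound (a := 2 * μ + 1) (by linarith)
  set F : ℕ → ℝ → ℂ := fun n x =>
    2 * c n / Complex.Gamma (α n) * ((x : ℂ) ^ ((α n : ℂ) - 1) • boseWeight p x)
  have hF (n : ℕ) : IntegrableOn (F n) (Ioi 0) :=
    (mellinConvergent_and_integral_norm_le hp (hα1 n)).1.const_mul _
  have hr' : |r| < 1 := by rwa [abs_of_pos hr0]
  have hsum : Summable fun n => ∫ x in Ioi (0 : ℝ), ‖F n x‖ := by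
    refine Summable.of_nonneg_of_le (fun n => integral_nonneg fun _ => norm_nonneg _) (fun n => ?_)
      ((summable_mathieu_majorant hμ le_rfl hr').mul_left (2 * C))
    simp only [F, norm_mul (2 * c n / Complex.Gamma (α n))]
    rw [integral_const_mul, norm_div, norm_mul, norm_mathieu_coeff hμ, Complex.Gamma_ofReal,
      Complex.norm_of_nonneg (hG n).le, RCLike.norm_ofNat, add_zero, div_self (hG n).ne', mul_one]
    have h1 := (mellinConvergent_and_integral_norm_le hp (hα1 n)).2
    have h2 : ‖riemannZeta (α n)‖ ≤ C := hC _ (by simpa using hα n)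
    have h3 : ∫ x in Ioi (0 : ℝ), ‖(x : ℂ) ^ ((α n : ℂ) - 1) • boseWeight p x‖ ≤
        Real.Gamma (α n) * C := h1.trans (mul_le_mul_of_nonneg_left h2 (hG n).le)
    have h4 := (norm_nonneg _).trans_eq (norm_mathieu_coeff hμ r n)
    rw [div_mul_eq_mul_div, div_le_iff₀ (hG n)]
    refine (mul_le_mul_of_nonneg_left h3 (by linarith)).trans (le_of_eq (by ring))
  have key := hasSum_integral_of_summable_integral_norm (μ := volume.restrict (Ioi (0 : ℝ))) hF hsum
  have h1 : mathieuPowerSeries μ p r = ∑' n, ∫ x in Ioi (0 : ℝ), F n x := by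
    rw [mathieuPowerSeries, ← tsum_mul_left]
    refine tsum_congr fun n => ?_
    have : (2 * μ + 2 * n + 1 : ℂ) = (α n : ℂ) := by simp [α]
    rw [this, zetaExt_eq_mellin, mellin, integral_const_mul]
    simp only [c]
    ring
  rw [h1, key.tsum_eq, ← integral_const_mul]
  refine setIntegral_congr_fun measurableSet_Ioi fun x hx => ?_
  have hx : 0 < x := hx
  have h2 : mathieuConst μ * (x ^ (2 * μ) * besselKernel μ (r * x)) =
      ∑' n : ℕ, r ^ (2 * n) * (-1) ^ n *
        (2 * (Real.Gamma (μ + n + 1) / (Real.Gamma (n + 1) * Real.Gamma (μ + 1))) /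
          Real.Gamma (2 * μ + 2 * n + 1)) * x ^ (2 * μ + 2 * n) := by
    rw [besselKernel, besselClifford, ← tsum_mul_left, ← tsum_mul_left]
    refine tsum_congr fun n => ?_
    have e : x ^ (2 * μ + 2 * n) = x ^ (2 * μ) * x ^ (2 * n) := by
      rw [Real.rpow_add hx, ← Real.rpow_natCast]
      push_cast
      rfl
    rw [mathieu_coeff_eq hμ, e,
      show -((r * x) ^ 2 / 4) = (-1) * r ^ 2 * x ^ 2 * (1 / 4) by ring]
    simp only [mul_pow, one_div, inv_pow, pow_mul]
    field_simp
  rw [← mul_assoc, ← Complex.ofReal_mul, h2, Complex.ofReal_tsum, ← tsum_mul_right]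
  refine tsum_congr fun n => ?_
  simp only [F, c, α, binom_add_natCast, smul_eq_mul]
  rw [Complex.ofReal_mul, ofReal_rpow_eq_cpow hx]
  push_cast [← Complex.Gamma_ofReal]
  rw [add_sub_cancel_right]
  ring

theorem mathieuExt_eq {μ r : ℝ} (hμ : 0 < μ) (hr0 : 0 < r) {p : ℂ} (hp : 0 ≤ p.re) :
    mathieuExt μ p r = mathieuConst μ *
      ∫ x in Ioi (0 : ℝ), ((x ^ (2 * μ) * besselKernel μ (r * x) : ℝ) : ℂ) * boseWeight p x := by
  rw [mathieuExt]
  split_ifs with h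
  · exact mathieuPowerSeries_eq hμ hr0 (by rwa [abs_of_pos hr0] at h) hp
  · exact mathieuIntegral_eq hr0 p

/-- Passing to `K_(μ+1)` gains one power of decay in `r`, which is what extends absolute convergence
of the Mellin integral to `Re s < μ + 1`. -/
theorem mathieuExt_eq_integral_deriv {μ r : ℝ} (hμ : 0 < μ) (hr0 : 0 < r) {p : ℂ}
    (hp : 0 < p.re) :
    mathieuExt μ p r = -(mathieuConst μ / 2) *
      ∫ x in Ioi (0 : ℝ), (besselKernel (μ + 1) (r * x) : ℂ) *
        ((x : ℂ) ^ (2 * μ + 1 : ℂ) * boseWeightDeriv p x) := by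
  obtain ⟨C, -, hC⟩ := exists_besselKernel_bound hμ
  obtain ⟨D, -, hD⟩ := exists_besselKernel_bound (μ := μ + 1) (by linarith)
  have hIBP := integral_mul_boseWeightDeriv hp
    (u := fun x : ℝ => ((x ^ (2 * μ + 1) * besselKernel (μ + 1) (r * x) : ℝ) : ℂ))
    (u' := fun x : ℝ => ((2 * x ^ (2 * μ) * besselKernel μ (r * x) : ℝ) : ℂ))
    (C := D) (b := 2 * μ + 1) (C' := 2 * C) (b' := 2 * μ)
    (fun x hx => (hasDerivAt_rpow_mul_besselKernel hμ r hx).ofReal_comp)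
    (Complex.continuous_ofReal.comp_continuousOn (ContinuousOn.mul
      (ContinuousOn.mul continuousOn_const fun x hx => (Real.continuousAt_rpow_const x _
        (Or.inl (ne_of_gt hx))).continuousWithinAt)
      ((continuous_besselKernel hμ).comp (by fun_prop)).continuousOn))
    (fun x hx => ?_) (fun x hx => ?_)
  · rw [mathieuExt_eq hμ hr0 hp.le]
    have e1 : ∫ x in Ioi (0 : ℝ), ((2 * x ^ (2 * μ) * besselKernel μ (r * x) : ℝ) : ℂ) *
        boseWeight p x = 2 * ∫ x in Ioi (0 : ℝ),
          ((x ^ (2 * μ) * besselKernel μ (r * x) : ℝ) : ℂ) * boseWeight p x := by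
      rw [← integral_const_mul]
      congr 1
      ext x
      push_cast
      ring
    have e2 : ∫ x in Ioi (0 : ℝ), (besselKernel (μ + 1) (r * x) : ℂ) *
        ((x : ℂ) ^ (2 * μ + 1 : ℂ) * boseWeightDeriv p x) =
        ∫ x in Ioi (0 : ℝ), ((x ^ (2 * μ + 1) * besselKernel (μ + 1) (r * x) : ℝ) : ℂ) *
          boseWeightDeriv p x := by
      refine setIntegral_congr_fun measurableSet_Ioi fun x hx => ?_
      rw [Complex.ofReal_mul, ofReal_rpow_eq_cpow hx]
      push_cast
      ring
    rw [e2, hIBP, e1]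
    ring
  · have := (hD (r * x) (by positivity)).1
    rw [Complex.norm_real, norm_mul, Real.norm_of_nonneg (by positivity), mul_comm]
    exact mul_le_mul_of_nonneg_right this (by positivity)
  · have := (hC (r * x) (by positivity)).1
    rw [Complex.norm_real, norm_mul, Real.norm_of_nonneg (by positivity)]
    calc 2 * x ^ (2 * μ) * ‖besselKernel μ (r * x)‖ ≤ 2 * x ^ (2 * μ) * C :=
          mul_le_mul_of_nonneg_left this (by positivity)
      _ = _ := by ring

/-! ### The Mathieu series: transform in `r`. -/

/-- With `w = μ + 1/2 - s/2`, the factor `2μ + 1 - s = 2w` left by the integration by parts cancels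
against `Γ(w+1) = w Γ(w)`; duplication at `w` does the rest. -/
theorem mathieuConst_mul_eq {μ : ℝ} (hμ : 0 < μ) {s : ℂ} (hs : 0 < s.re) (hs' : s.re < μ + 1) :
    mathieuConst μ / 2 * (2 ^ (s - 1) * Complex.Gamma (s / 2) /
      Complex.Gamma (μ + 3 / 2 - s / 2)) * (2 * μ + 1 - s) =
    Complex.betaIntegral (s / 2) (μ + 1 - s / 2) / Complex.Gamma (2 * μ + 1 - s) := by
  have h1 : 0 < (s / 2).re := by simpa using hs
  have h2 : 0 < (μ + 1 - s / 2).re := by simp; linarith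
  have h3 : 0 < (μ + 1 / 2 - s / 2).re := by simp; linarith
  have h4 : 0 < (2 * μ + 1 - s).re := by simp; linarith
  have h5 : (μ + 1 / 2 - s / 2) ≠ 0 := fun h => by rw [h] at h3; simp at h3
  have hd := Complex.Gamma_mul_Gamma_add_half (μ + 1 / 2 - s / 2)
  rw [show μ + 1 / 2 - s / 2 + 1 / 2 = μ + 1 - s / 2 by ring] at hd
  have e1 : (2 * μ + 1 - s : ℂ) = 2 * (μ + 1 / 2 - s / 2) := by ring
  rw [e1] at h4
  have g2 := Complex.Gamma_ne_zero_of_re_pos h3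
  have g3 := Complex.Gamma_ne_zero_of_re_pos h4
  have g4 : Complex.Gamma (μ + 1) ≠ 0 := Complex.Gamma_ne_zero_of_re_pos (by simp; linarith)
  have hcast : ((Real.Gamma (μ + 1) : ℝ) : ℂ) = Complex.Gamma (μ + 1) := by
    rw [← Complex.Gamma_ofReal, Complex.ofReal_add, Complex.ofReal_one]
  have e2 : (2 : ℂ) ^ (1 - 2 * (μ + 1 / 2 - s / 2)) =
      2 ^ (s - 1) * ((4 ^ (1 / 2 - μ) : ℝ) : ℂ) := by
    have : (4 : ℝ) ^ (1 / 2 - μ) = 2 ^ (1 - 2 * μ) := by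
      rw [show (4 : ℝ) = 2 ^ (2 : ℝ) by norm_num, ← Real.rpow_mul two_pos.le]
      ring_nf
    rw [this, Complex.ofReal_cpow two_pos.le, Complex.ofReal_ofNat, ← Complex.cpow_add _ _ two_ne_zero]
    push_cast
    ring_nf
  rw [e2] at hd
  rw [Complex.betaIntegral_eq_Gamma_mul_div _ _ h1 h2, e1,
    show (s / 2 + (μ + 1 - s / 2) : ℂ) = μ + 1 by ring,
    show (μ : ℂ) + 3 / 2 - s / 2 = (μ + 1 / 2 - s / 2) + 1 by ring, Complex.Gamma_add_one _ h5,
    mathieuConst, Complex.ofReal_div, Complex.ofReal_mul, hcast]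
  generalize (μ + 1 / 2 - s / 2 : ℂ) = w at *
  generalize ((4 ^ (1 / 2 - μ) : ℝ) : ℂ) = A at *
  generalize (2 : ℂ) ^ (s - 1) = B at *
  generalize Complex.Gamma (μ + 1 - s / 2) = G at *
  field_simp
  linear_combination -(Complex.Gamma (s / 2) * hd)

theorem hasMellin_mathieuExt_right {μ : ℝ} (hμ : 0 < μ) {p s : ℂ} (hp : 0 < p.re)
    (hs : 0 < s.re) (hs' : s.re < μ + 1) :
    HasMellin (fun r : ℝ => mathieuExt μ p r) s
      (Complex.betaIntegral (s / 2) (μ + 1 - s / 2) * zetaExt p (2 * μ - s + 1)) := by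
  set h : ℝ → ℂ := fun x => (x : ℂ) ^ (2 * μ + 1 : ℂ) * boseWeightDeriv p x
  have hE : EqOn (fun x : ℝ => (x : ℂ) ^ (2 * μ + 1 - s : ℂ) * boseWeightDeriv p x)
      (fun x : ℝ => (x : ℂ) ^ (-s) * h x) (Ioi 0) := fun x hx => by
    have hx' : (x : ℂ) ≠ 0 := by exact_mod_cast (ne_of_gt hx)
    simp only [h]
    rw [sub_eq_neg_add, Complex.cpow_add _ _ hx', mul_assoc]
  have hcpow (a : ℂ) : ContinuousOn (fun x : ℝ => (x : ℂ) ^ a) (Ioi 0) := fun x hx =>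
    (Complex.continuousAt_ofReal_cpow_const x a (Or.inr (ne_of_gt hx))).continuousWithinAt
  have hint : IntegrableOn (fun x : ℝ => (x : ℂ) ^ (-s) * h x) (Ioi 0) :=
    IntegrableOn.congr_fun (integrableOn_mul_boseWeightDeriv hp (hcpow (2 * μ + 1 - s)) (C := 1)
      (b := (2 * μ + 1 - s : ℂ).re) fun x hx => by
        rw [Complex.norm_cpow_eq_rpow_re_of_pos hx, one_mul]) hE measurableSet_Ioi
  have hμ1 : 0 < μ + 1 := by linarith
  have key := hasMellin_integral_comp_mul (k := fun y => (besselKernel (μ + 1) y : ℂ)) (h := h)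
    (Complex.continuous_ofReal.comp (continuous_besselKernel hμ1))
    (mellinConvergent_besselKernel hμ1 hs hs')
    ((hcpow _).mul (continuousOn_boseWeightDeriv p)) hint
  rw [← setIntegral_congr_fun measurableSet_Ioi hE, integral_cpow_mul_boseWeightDeriv hp,
    mellin_besselKernel hμ1 hs hs'] at key
  have key2 := hasMellin_const_smul key.1 (-(mathieuConst μ / 2) : ℂ)
  rw [key.2] at key2
  have hfun : EqOn (fun r : ℝ => (r : ℂ) ^ (s - 1) • ((-(mathieuConst μ / 2) : ℂ) •
      ∫ x in Ioi (0 : ℝ), (besselKernel (μ + 1) (r * x) : ℂ) * h x))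
      (fun r : ℝ => (r : ℂ) ^ (s - 1) • mathieuExt μ p r) (Ioi 0) := fun r hr => by
    simp only [mathieuExt_eq_integral_deriv hμ hr hp, h, smul_eq_mul]
  refine ⟨key2.1.congr_fun hfun measurableSet_Ioi, ?_⟩
  rw [mellin, ← setIntegral_congr_fun measurableSet_Ioi hfun]
  refine key2.2.trans ?_
  have hc := mathieuConst_mul_eq hμ hs hs'
  rw [zetaExt_eq_mellin, show (2 * μ - s + 1 : ℂ) = 2 * μ + 1 - s by ring, ← mul_assoc,
    mul_one_div, ← hc, smul_eq_mul]
  push_cast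
  rw [show (μ : ℂ) + 1 + 1 / 2 - s / 2 = μ + 3 / 2 - s / 2 by ring]
  ring

end ExtMathieu

theorem mainTheorem2 (μ : ℝ) (hμ : 0 < μ) :
    (∀ (r : ℝ) (s : ℂ), |r| < 1 → 0 < s.re →
      Summable (fun n : ℕ =>
        (-(r : ℂ) ^ 2) ^ n * ExtMathieu.binom (μ + n) n *
          ExtMathieu.binom (2 * μ + 2 * n + s) (2 * μ + 2 * n) *
          riemannZeta (2 * μ + 2 * n + s + 1)) ∧
      HasMellin (fun p : ℝ => ExtMathieu.mathieuExt μ (p : ℂ) r) s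
        (2 * s * Complex.Gamma s ^ 2 *
          ∑' n : ℕ, (-(r : ℂ) ^ 2) ^ n * ExtMathieu.binom (μ + n) n *
            ExtMathieu.binom (2 * μ + 2 * n + s) (2 * μ + 2 * n) *
            riemannZeta (2 * μ + 2 * n + s + 1))) ∧
    (∀ (p s : ℂ), 0 < p.re → 0 < s.re → s.re < μ + 1 →
      HasMellin (fun r : ℝ => ExtMathieu.mathieuExt μ p r) s
        (Complex.betaIntegral (s / 2) (μ + 1 - s / 2) *
          ExtMathieu.zetaExt p (2 * μ - s + 1))) :=
  ⟨fun _ _ hr hs => ExtMathieu.summable_and_hasMellin_mathieuExt hμ hr hs,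
    fun _ _ hp hs hs' => ExtMathieu.hasMellin_mathieuExt_right hμ hp hs hs'⟩
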